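/- For $n \ge 0$, let $A_n$ be the alternating subgroup of the symmetric group $S_n$ of all permutations of $n$ points. For a nonempty finite subset $C \subseteq S_n$, let $\delta(C)$ be the proportion of elements of $C$ without fixed points, i.e. $$\delta(C) = \frac{|\{\sigma \in C : \sigma \text{ has no fixed points}\}|}{|C|}.$$ Let $D_n$ be the number of fixed-point-free elements of $S_n$, and for $n \ge 1$ let $E_n = D_n + (-1)^{n-1}(n-1)$. "Coset" means left or right coset. (a) For every $n \ge 1$, $\delta(A_n) = E_n/n!$. (b) Let $n \ge 7$, let $G$ be a subgroup of $S_n$, and let $C$ be a coset of $G$ in $S_n$ with $\delta(C) = \delta(A_n)$. Then $G = A_n$. (c) For $n \le 6$, the subgroups $G \ne A_n$ of $S_n$ that have a coset $C$ in $S_n$ with $\delta(C) = \delta(A_n)$ are exactly the following (so there are none for $n \le 3$): - $n = 4$: the conjugates of the order $4$ subgroup generated by $(1423)$ and $(12)(34)$; the conjugates of the order $4$ subgroup generated by $(34)$ and $(12)(34)$; and the subgroups of order $8$; - $n = 5$: the subgroups of order $5$, $10$ or $20$; - $n = 6$: the conjugates of the order $36$ subgroup generated by $(1623)(45)$, $(12)(36)$,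 $(124)(365)$ and $(142)(365)$; and the conjugates of the order $36$ subgroup generated by $(13)(25)(46)$, $(14)(36)$, $(154)(236)$ and $(145)(236)$. -/

import Mathlib

open scoped Pointwise Nat

namespace DerangementProportion

open Equiv

/-- The proportion of elements of a set `S` of permutations of `{0, …, n - 1}` that have no fixed
point. -/
noncomputable def fpfProportion {n : ℕ} (S : Set (Perm (Fin n))) : ℚ :=
  ((S ∩ derangements (Fin n)).ncard : ℚ) / (S.ncard : ℚ)

/-- `C` is a (left or right) coset of `G` in the symmetric group. -/
def IsCosetOf {n : ℕ} (C : Set (Perm (Fin n))) (G : Subgroup (Perm (Fin n))) : Prop :=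
  ∃ g : Perm (Fin n), C = g • (G : Set (Perm (Fin n))) ∨
    C = MulOpposite.op g • (G : Set (Perm (Fin n)))

/-- The integer `E_n = D_n + (-1)^(n-1) (n-1)`, for `n ≥ 1`, where `D_n` is the number of
derangements of `n` objects. -/
def E (n : ℕ) : ℤ := (numDerangements n : ℤ) + (-1) ^ (n - 1) * ((n : ℤ) - 1)

/-- `G` and `H` are conjugate subgroups of the symmetric group. -/
def IsConjSubgroup {n : ℕ} (G H : Subgroup (Perm (Fin n))) : Prop :=
  ∃ g : Perm (Fin n), G = H.map (MulAut.conj g).toMonoidHom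

/-- The cycle `(a₁ a₂ … a_k)` on pairwise distinct points, given as a list. -/
abbrev cyc {n : ℕ} (l : List (Fin n)) : Perm (Fin n) := l.formPerm

/-- The exceptional subgroups in degree at most `6`. The points `1, …, n` of the usual cycle
notation are `0, …, n - 1` here; the usual notation of the generators is given alongside. -/
def IsExceptional : (n : ℕ) → Subgroup (Perm (Fin n)) → Prop
  | 4, G =>
      -- (1423), (12)(34)
      (Nat.card G = 4 ∧ IsConjSubgroup G (Subgroup.closure
        {cyc [0, 3, 1, 2], cyc [0, 1] * cyc [2, 3]})) ∨
      -- (34), (12)(34)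
      (Nat.card G = 4 ∧ IsConjSubgroup G (Subgroup.closure
        {cyc [2, 3], cyc [0, 1] * cyc [2, 3]})) ∨
      Nat.card G = 8
  | 5, G => Nat.card G = 5 ∨ Nat.card G = 10 ∨ Nat.card G = 20
  | 6, G =>
      -- (1623)(45), (12)(36), (124)(365), (142)(365)
      (Nat.card G = 36 ∧ IsConjSubgroup G (Subgroup.closure
        {cyc [0, 5, 1, 2] * cyc [3, 4], cyc [0, 1] * cyc [2, 5],
          cyc [0, 1, 3] * cyc [2, 5, 4], cyc [0, 3, 1] * cyc [2, 5, 4]})) ∨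
      -- (13)(25)(46), (14)(36), (154)(236), (145)(236)
      (Nat.card G = 36 ∧ IsConjSubgroup G (Subgroup.closure
        {cyc [0, 2] * cyc [1, 4] * cyc [3, 5], cyc [0, 3] * cyc [2, 5],
          cyc [0, 4, 3] * cyc [1, 2, 5], cyc [0, 3, 4] * cyc [1, 2, 5]}))
  | _, _ => False

end DerangementProportion

namespace DerangementProportion
open Equiv

/-! The signed count of derangements is the determinant of the all-ones matrix minus the identity,
namely `(-1)^(n-1) (n-1)`. Half the sum of this and `D_n` counts the even derangements, which gives
the proportion in `A_n`. For a coset `C` of `G`, equality of proportions then says that (number of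
derangements in `C`) * (index of `G`) = `E n`. In particular the index of `G` divides both `E n` and
`n!`. Nearly all of the proof uses only this divisibility; the actual counts enter for a few groups
of degree at most 7.

The recursion for `D_n` shows that `E n` is, up to sign, 2 modulo `n`, 4 modulo `n - 3`, 6 modulo `n
- 4` and 48 modulo `n - 5`. Hence a prime dividing one of these numbers can divide the index only if
it divides the small constant. If `p` does not divide the index, every `p`-subgroup of `S_n` is
conjugate into `G`, so `G` contains as many disjoint `p`-cycles as fit.

Let `n ≥ 7`. An intransitive `G` has index divisible by some `n.choose k`; the residue modulo `n`
forces `n = 2k`, and the residue modulo `n - 3` forces `k ≤ 3`. Two blocks of imprimitivity are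
excluded in the same way, at the cost of a factor 2. With `a ≥ 3` blocks of size `b`, counting the
fixed points of a maximal product of disjoint `p`-cycles gives `a (b mod p) = n mod p`. Taking `p`
dividing `n - 3`, `n - 4` or `n - 5` makes `a` divide 3, 4 or 5; if no suitable `p` exists, these
numbers are powers of 2, 3 or 5, and congruences rule that out. So `G` is primitive. For `n ≥ 8`
some prime `p ≤ n - 3` does not divide `E n`, so `G` contains a `p`-cycle and Jordan's theorem gives
`A_n ≤ G`; index one is impossible, so `G = A_n`.

For `n = 7` only a 7-cycle is guaranteed. A finite check leaves, apart from groups of order at most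
42 (too small) and those containing `A_7`, the automorphism group of the Fano plane, of order 168,
and no coset of it has the required 62 derangements. For `n ≤ 6` the divisibility leaves few orders,
and the remaining groups are identified and their cosets counted. -/

/-- The number of derangements in the left coset `g G`. -/
noncomputable def cosetCount {n : ℕ} (G : Subgroup (Perm (Fin n))) (g : Perm (Fin n)) : ℕ :=
  {h : Perm (Fin n) | h ∈ G ∧ g * h ∈ derangements (Fin n)}.ncard

/-! ### Even derangements and the proportion in the alternating group -/

theorem sum_sign_derangements (n : ℕ) (hn : 1 ≤ n) :
    ∑ σ : Perm (Fin n), (if σ ∈ derangements (Fin n) then (Perm.sign σ : ℤ) else 0) =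
      (-1) ^ (n - 1) * ((n : ℤ) - 1) := by
  classical
  set M : Matrix (Fin n) (Fin n) ℤ := Matrix.of fun i j => if i = j then 0 else 1 with hM
  have h1 : M.det =
      ∑ σ : Perm (Fin n), (if σ ∈ derangements (Fin n) then (Perm.sign σ : ℤ) else 0) := by
    rw [Matrix.det_apply]
    refine Finset.sum_congr rfl fun σ _ => ?_
    split_ifs with h
    · rw [Finset.prod_eq_one]
      · simp [Units.smul_def]
      · intro i _
        simp [hM, h i]
    · obtain ⟨i, hi⟩ : ∃ i, σ i = i := by simpa [derangements] using h
      rw [Finset.prod_eq_zero (Finset.mem_univ i)]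
      · simp
      · simp [hM, hi]
  -- A rank-one perturbation of the identity: `det (1 - uv) = det (1 - vu)` reduces the determinant
  -- to the scalar `1 - n`.
  have h2 : M = -(1 - Matrix.replicateCol Unit (fun _ => (1 : ℤ)) *
      Matrix.replicateRow Unit (fun _ => (1 : ℤ))) := by
    ext i j
    by_cases hij : i = j <;> simp [hM, Matrix.mul_apply, hij]
  rw [← h1, h2, Matrix.det_neg, Matrix.det_one_sub_mul_comm]
  obtain ⟨k, rfl⟩ := Nat.exists_eq_add_of_le' hn
  simp [Matrix.mul_apply, pow_succ]

theorem card_even_derangements (n : ℕ) (hn : 1 ≤ n) :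
    2 * (((alternatingGroup (Fin n) : Set (Perm (Fin n))) ∩ derangements (Fin n)).ncard : ℤ) =
      E n := by
  classical
  have h := sum_sign_derangements n hn
  have hD : (numDerangements n : ℤ) =
      ∑ σ : Perm (Fin n), (if σ ∈ derangements (Fin n) then 1 else 0) := by
    rw [← card_derangements_fin_eq_numDerangements, Fintype.card_subtype]
    simp
  have hA : (((alternatingGroup (Fin n) : Set (Perm (Fin n))) ∩
      derangements (Fin n)).ncard : ℤ) =
      ∑ σ : Perm (Fin n),
        (if σ ∈ alternatingGroup (Fin n) ∧ σ ∈ derangements (Fin n) then 1 else 0) := by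
    rw [Set.ncard_eq_toFinset_card']
    simp only [Finset.sum_boole, Nat.cast_inj]
    congr 1
    ext σ
    simp
  rw [E, ← h, hD, hA, Finset.mul_sum, ← Finset.sum_add_distrib]
  refine Finset.sum_congr rfl fun σ _ => ?_
  rcases Int.units_eq_one_or (Perm.sign σ) with hs | hs <;>
    by_cases hd : σ ∈ derangements (Fin n) <;>
    simp [hs, hd, Perm.mem_alternatingGroup]

theorem fpfProportion_alternatingGroup (n : ℕ) (hn : 1 ≤ n) :
    fpfProportion (alternatingGroup (Fin n) : Set (Perm (Fin n))) = (E n : ℚ) / (n ! : ℚ) := by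
  have h := card_even_derangements n hn
  -- For `n = 1` the alternating group has index one, so `2 |A_n| = n!` fails and the case is
  -- separate.
  rcases hn.eq_or_lt with rfl | hn2
  · have hE : E 1 = 0 := by simp [E]
    rw [hE] at h ⊢
    have : ((alternatingGroup (Fin 1) : Set (Perm (Fin 1))) ∩ derangements (Fin 1)).ncard = 0 := by
      omega
    simp [fpfProportion, this]
  · have : Nontrivial (Fin n) := Fin.nontrivial_iff_two_le.mpr hn2
    have hc := two_mul_card_alternatingGroup (α := Fin n)
    rw [Fintype.card_perm, Fintype.card_fin, ← Nat.card_eq_fintype_card] at hc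
    have hc' : ((alternatingGroup (Fin n) : Set (Perm (Fin n))).ncard) =
      Nat.card (alternatingGroup (Fin n)) := rfl
    rw [fpfProportion, hc', ← h, ← hc]
    have : (Nat.card (alternatingGroup (Fin n)) : ℚ) ≠ 0 := by
      exact_mod_cast Nat.card_pos.ne'
    push_cast
    field_simp

/-! ### Cosets and the equation between count, index and `E n` -/

theorem derangements_conj_mem {α : Type*} (g h : Perm α) :
    g * h * g⁻¹ ∈ derangements α ↔ h ∈ derangements α := by
  constructor
  · intro H x hx
    exact H (g x) (by simp [hx])
  · intro H x hx
    refine H (g⁻¹ x) ?_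
    have := congrArg (g⁻¹ : Perm α) hx
    simpa using this

theorem cosetCount_eq_left {n : ℕ} (G : Subgroup (Perm (Fin n))) (g : Perm (Fin n)) :
    (g • (G : Set (Perm (Fin n))) ∩ derangements (Fin n)).ncard = cosetCount G g := by
  symm
  rw [cosetCount, ← Set.ncard_image_of_injective _ (mul_right_injective g)]
  congr 1
  ext x
  simp only [Set.mem_inter_iff, Set.mem_image, Set.mem_ofPred_eq, Set.mem_smul_set,
    SetLike.mem_coe, smul_eq_mul]
  constructor
  · rintro ⟨y, ⟨hy, hx⟩, rfl⟩
    exact ⟨⟨y, hy, rfl⟩, hx⟩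
  · rintro ⟨⟨y, hy, rfl⟩, hx⟩
    exact ⟨y, ⟨hy, hx⟩, rfl⟩

/-- Conjugation by `g` turns `y * g` into `g * y` and preserves derangements, so right cosets give
nothing new. -/
theorem cosetCount_eq_right {n : ℕ} (G : Subgroup (Perm (Fin n))) (g : Perm (Fin n)) :
    (MulOpposite.op g • (G : Set (Perm (Fin n))) ∩ derangements (Fin n)).ncard =
      cosetCount G g := by
  symm
  rw [cosetCount, ← Set.ncard_image_of_injective _ (mul_left_injective g)]
  congr 1
  ext x
  simp only [Set.mem_inter_iff, Set.mem_image, Set.mem_ofPred_eq, Set.mem_smul_set,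
    SetLike.mem_coe, MulOpposite.smul_eq_mul_unop, MulOpposite.unop_op]
  have key : ∀ y : Perm (Fin n), y * g ∈ derangements (Fin n) ↔ g * y ∈ derangements (Fin n) := by
    intro y
    rw [← derangements_conj_mem g (y * g)]
    simp [mul_assoc]
  constructor
  · rintro ⟨y, ⟨hy, hx⟩, rfl⟩
    exact ⟨⟨y, hy, rfl⟩, (key y).2 hx⟩
  · rintro ⟨⟨y, hy, rfl⟩, hx⟩
    exact ⟨y, ⟨hy, (key y).1 hx⟩, rfl⟩

theorem fpfProportion_eq_iff {n : ℕ} (hn : 1 ≤ n) (G : Subgroup (Perm (Fin n)))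
    (C : Set (Perm (Fin n))) (c : ℕ) (hcard : C.ncard = Nat.card G)
    (hc : (C ∩ derangements (Fin n)).ncard = c) :
    fpfProportion C = fpfProportion (alternatingGroup (Fin n) : Set (Perm (Fin n))) ↔
      (c : ℤ) * G.index = E n := by
  rw [fpfProportion_alternatingGroup n hn, fpfProportion, hcard, hc]
  have h := G.card_mul_index
  rw [Nat.card_eq_fintype_card (α := Perm (Fin n)), Fintype.card_perm, Fintype.card_fin] at h
  have h1 : (Nat.card G : ℚ) ≠ 0 := by exact_mod_cast Nat.card_pos.ne'
  have h2 : (G.index : ℚ) ≠ 0 := by exact_mod_cast G.index_ne_zero_of_finite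
  rw [← h]
  push_cast
  rw [div_eq_div_iff h1 (mul_ne_zero h1 h2)]
  rw [mul_left_comm, mul_comm (E n : ℚ), mul_right_inj' h1]
  exact_mod_cast Iff.rfl

theorem exists_cosetCount_of_isCosetOf {n : ℕ} (hn : 1 ≤ n) {G : Subgroup (Perm (Fin n))}
    {C : Set (Perm (Fin n))} (hC : IsCosetOf C G)
    (h : fpfProportion C = fpfProportion (alternatingGroup (Fin n) : Set (Perm (Fin n)))) :
    ∃ g, (cosetCount G g : ℤ) * G.index = E n := by
  obtain ⟨g, rfl | rfl⟩ := hC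
  · exact ⟨g, (fpfProportion_eq_iff hn G _ _ (Set.ncard_smul_set g _)
      (cosetCount_eq_left G g)).1 h⟩
  · exact ⟨g, (fpfProportion_eq_iff hn G _ _ (Set.ncard_smul_set (MulOpposite.op g) _)
      (cosetCount_eq_right G g)).1 h⟩

theorem exists_isCosetOf_iff {n : ℕ} (hn : 1 ≤ n) (G : Subgroup (Perm (Fin n))) :
    (∃ C : Set (Perm (Fin n)), IsCosetOf C G ∧ fpfProportion C =
      fpfProportion (alternatingGroup (Fin n) : Set (Perm (Fin n)))) ↔
    ∃ g, (cosetCount G g : ℤ) * G.index = E n := by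
  constructor
  · rintro ⟨C, hC, h⟩
    exact exists_cosetCount_of_isCosetOf hn hC h
  · rintro ⟨g, hg⟩
    exact ⟨g • (G : Set (Perm (Fin n))), ⟨g, Or.inl rfl⟩,
      (fpfProportion_eq_iff hn G _ _ (Set.ncard_smul_set g _) (cosetCount_eq_left G g)).2 hg⟩

theorem cosetCount_conj {n : ℕ} (G : Subgroup (Perm (Fin n))) (x g : Perm (Fin n)) :
    cosetCount (G.map (MulAut.conj x).toMonoidHom) (x * g * x⁻¹) = cosetCount G g := by
  symm
  rw [cosetCount, cosetCount, ← Set.ncard_image_of_injective _ (MulAut.conj x).injective]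
  congr 1
  ext y
  simp only [Set.mem_ofPred_eq, Set.mem_image, Subgroup.mem_map]
  have key : ∀ h : Perm (Fin n), x * g * x⁻¹ * (x * h * x⁻¹) ∈ derangements (Fin n) ↔
      g * h ∈ derangements (Fin n) := by
    intro h
    rw [← derangements_conj_mem x (g * h)]
    simp [mul_assoc]
  constructor
  · rintro ⟨h, ⟨hh, hy⟩, rfl⟩
    exact ⟨⟨h, hh, rfl⟩, (key h).2 hy⟩
  · rintro ⟨⟨h, hh, rfl⟩, hy⟩
    exact ⟨h, ⟨hh, (key h).1 hy⟩, rfl⟩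

theorem index_map_conj {H : Type*} [Group H] (G : Subgroup H) (x : H) :
    (G.map (MulAut.conj x).toMonoidHom).index = G.index :=
  G.index_map_equiv (MulAut.conj x)

/-- The condition `∃ g, δ(gG) = δ(A_n)` is invariant under conjugation of `G`. -/
theorem exists_cosetCount_conj {n : ℕ} {G : Subgroup (Perm (Fin n))} (x : Perm (Fin n))
    (h : ∃ g, (cosetCount G g : ℤ) * G.index = E n) :
    ∃ g, (cosetCount (G.map (MulAut.conj x).toMonoidHom) g : ℤ) *
      (G.map (MulAut.conj x).toMonoidHom).index = E n := by
  obtain ⟨g, hg⟩ := h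
  exact ⟨x * g * x⁻¹, by rw [cosetCount_conj, index_map_conj, hg]⟩

theorem cosetCount_top {n : ℕ} (g : Perm (Fin n)) :
    cosetCount (⊤ : Subgroup (Perm (Fin n))) g = numDerangements n := by
  rw [← cosetCount_eq_left, ← card_derangements_fin_eq_numDerangements,
    Subgroup.coe_top, Set.smul_set_univ, Set.univ_inter, ← Nat.card_coe_set_eq,
    Nat.card_eq_fintype_card]

/-- For the full symmetric group the equation would read `D_n = E_n`, but the two differ by `±(n -
1)`. -/
theorem index_ne_one {n : ℕ} (hn : 2 ≤ n) {G : Subgroup (Perm (Fin n))} {g : Perm (Fin n)}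
    (h : (cosetCount G g : ℤ) * G.index = E n) : G ≠ ⊤ := by
  rintro rfl
  rw [cosetCount_top, Subgroup.index_top, E] at h
  have : ((-1 : ℤ) ^ (n - 1)) ≠ 0 := by positivity
  have h2 : (n : ℤ) - 1 ≠ 0 := by omega
  have := mul_ne_zero this h2
  omega

theorem eq_alternatingGroup_of_le {n : ℕ} (hn : 2 ≤ n) {G : Subgroup (Perm (Fin n))}
    {g : Perm (Fin n)} (h : (cosetCount G g : ℤ) * G.index = E n)
    (hG : alternatingGroup (Fin n) ≤ G) : G = alternatingGroup (Fin n) := by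
  have : Nontrivial (Fin n) := Fin.nontrivial_iff_two_le.mpr hn
  have h1 := Subgroup.index_dvd_of_le hG
  rw [alternatingGroup.index_eq_two] at h1
  rcases (Nat.dvd_prime Nat.prime_two).1 h1 with h2 | h2
  · exact absurd (Subgroup.index_eq_one.1 h2) (index_ne_one hn h)
  · exact Perm.eq_alternatingGroup_of_index_eq_two h2

/-! ### Congruences for `E n` -/

theorem numDerangements_rec (n : ℕ) :
    (numDerangements (n + 1) : ℤ) = (n + 1) * numDerangements n - (-1) ^ n :=
  numDerangements_succ n

theorem E_succ (n : ℕ) : E (n + 1) = numDerangements (n + 1) + (-1) ^ n * n := by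
  simp [E]

/-- Unfolding the recursion down to `D_k` leaves a multiple of `k + 1` and an alternating tail,
polynomial in `k`. Dividing the tail by `k + 1` gives the quotient, and its value at `k = -1` the
constant. The shifts 1 and 2 are absent since `E n` vanishes modulo `n - 1` and `n - 2`. -/
theorem dvd_E_zero (k : ℕ) : ∃ q : ℤ, E (k + 1) = (k + 1) * q - 2 * (-1) ^ k := by
  refine ⟨numDerangements k + (-1) ^ k, ?_⟩
  rw [E_succ, numDerangements_rec]
  ring

theorem dvd_E_three (k : ℕ) : ∃ q : ℤ, E (k + 1 + 3) = (k + 1) * q - 4 * (-1) ^ k := by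
  refine ⟨numDerangements k * ((k + 2) * (k + 3) * (k + 4)) +
    (-1) ^ k * (-14 - 7 * k - k ^ 2), ?_⟩
  rw [show k + 1 + 3 = k + 3 + 1 by ring, E_succ]
  simp only [numDerangements_rec]
  push_cast
  ring

theorem dvd_E_four (k : ℕ) : ∃ q : ℤ, E (k + 1 + 4) = (k + 1) * q - 6 * (-1) ^ k := by
  refine ⟨numDerangements k * ((k + 2) * (k + 3) * (k + 4) * (k + 5)) +
    (-1) ^ k * (-66 - 48 * k - 12 * k ^ 2 - k ^ 3), ?_⟩
  rw [show k + 1 + 4 = k + 4 + 1 by ring, E_succ]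
  simp only [numDerangements_rec]
  push_cast
  ring

theorem dvd_E_five (k : ℕ) : ∃ q : ℤ, E (k + 1 + 5) = (k + 1) * q - 48 * (-1) ^ k := by
  refine ⟨numDerangements k * ((k + 2) * (k + 3) * (k + 4) * (k + 5) * (k + 6)) +
    (-1) ^ k * (-412 - 355 * k - 120 * k ^ 2 - 18 * k ^ 3 - k ^ 4), ?_⟩
  rw [show k + 1 + 5 = k + 5 + 1 by ring, E_succ]
  simp only [numDerangements_rec]
  push_cast
  ring

theorem natAbs_dvd_of_dvd_mul_sub {d N : ℕ} {k c : ℕ} {q : ℤ} {e : ℤ}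
    (he : e = (N : ℤ) * q - c * (-1) ^ k) (hd : (d : ℤ) ∣ e) (hN : d ∣ N) : d ∣ c := by
  have h1 : (d : ℤ) ∣ (N : ℤ) * q := (Int.natCast_dvd_natCast.2 hN).mul_right _
  have h2 : (d : ℤ) ∣ c * (-1) ^ k := by
    have := dvd_sub h1 hd
    rwa [he, sub_sub_cancel] at this
  have h3 : (d : ℤ) ∣ c := by
    have := h2.mul_right ((-1) ^ k)
    rwa [mul_assoc, ← mul_pow, neg_one_mul, neg_neg, one_pow, mul_one] at this
  exact Int.natCast_dvd_natCast.1 h3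

theorem dvd_two_of_dvd_E {d n : ℕ} (hn : 1 ≤ n) (hd : (d : ℤ) ∣ E n) (h : d ∣ n) : d ∣ 2 := by
  obtain ⟨k, rfl⟩ := Nat.exists_eq_add_of_le' hn
  obtain ⟨q, hq⟩ := dvd_E_zero k
  exact natAbs_dvd_of_dvd_mul_sub (c := 2) (by rw [hq]; push_cast; rfl) hd h

theorem dvd_four_of_dvd_E {d n : ℕ} (hn : 4 ≤ n) (hd : (d : ℤ) ∣ E n) (h : d ∣ n - 3) :
    d ∣ 4 := by
  obtain ⟨k, rfl⟩ := Nat.exists_eq_add_of_le' hn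
  obtain ⟨q, hq⟩ := dvd_E_three k
  exact natAbs_dvd_of_dvd_mul_sub (c := 4) (N := k + 1)
    (by rw [show k + 4 = k + 1 + 3 by ring, hq]; push_cast; rfl) hd h

theorem dvd_six_of_dvd_E {d n : ℕ} (hn : 5 ≤ n) (hd : (d : ℤ) ∣ E n) (h : d ∣ n - 4) :
    d ∣ 6 := by
  obtain ⟨k, rfl⟩ := Nat.exists_eq_add_of_le' hn
  obtain ⟨q, hq⟩ := dvd_E_four k
  exact natAbs_dvd_of_dvd_mul_sub (c := 6) (N := k + 1)
    (by rw [show k + 5 = k + 1 + 4 by ring, hq]; push_cast; rfl) hd h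

theorem dvd_forty_eight_of_dvd_E {d n : ℕ} (hn : 6 ≤ n) (hd : (d : ℤ) ∣ E n)
    (h : d ∣ n - 5) : d ∣ 48 := by
  obtain ⟨k, rfl⟩ := Nat.exists_eq_add_of_le' hn
  obtain ⟨q, hq⟩ := dvd_E_five k
  exact natAbs_dvd_of_dvd_mul_sub (c := 48) (N := k + 1)
    (by rw [show k + 6 = k + 1 + 5 by ring, hq]; push_cast; rfl) hd h

end DerangementProportion

namespace DerangementProportion
open Equiv

/-! ### Sylow-type conjugation and Jordan's theorem on prime cycles -/

/-- If `p` does not divide the index of `G`, every `p`-subgroup is conjugate into `G`. -/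
theorem exists_conj_mem_of_isPGroup {H : Type*} [Group H] [Finite H] {p : ℕ} [Fact p.Prime]
    {G Q : Subgroup H} (hQ : IsPGroup p Q) (h : ¬ p ∣ G.index) :
    ∃ g : H, ∀ q ∈ Q, g * q * g⁻¹ ∈ G := by
  -- `Q` acts on the cosets of `G`, whose number is prime to `p`, so it fixes one.
  obtain ⟨x, hx⟩ := hQ.nonempty_fixed_point_of_prime_not_dvd_card (H ⧸ G)
    (by rwa [← Subgroup.index_eq_card])
  obtain ⟨g, rfl⟩ := QuotientGroup.mk_surjective x
  refine ⟨g⁻¹, fun q hq => ?_⟩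
  have h1 : (QuotientGroup.mk (q * g) : H ⧸ G) = QuotientGroup.mk g := hx ⟨q, hq⟩
  have h2 := QuotientGroup.eq.1 h1.symm
  simpa [mul_assoc] using h2

theorem isPGroup_closure_of_commute {H : Type*} [Group H] {p : ℕ} {S : Set H}
    (hc : ∀ x ∈ S, ∀ y ∈ S, Commute x y) (hp : ∀ x ∈ S, x ^ p = 1) :
    IsPGroup p (Subgroup.closure S) := by
  have h1 : ∀ x ∈ Subgroup.closure S, ∀ y ∈ S, Commute x y := by
    intro x hx y hy
    have : Subgroup.closure S ≤ Subgroup.centralizer {y} := by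
      rw [Subgroup.closure_le]
      intro z hz
      exact Subgroup.mem_centralizer_singleton_iff.2 (hc z hz y hy)
    exact Subgroup.mem_centralizer_singleton_iff.1 (this hx)
  have h2 : ∀ x ∈ Subgroup.closure S, ∀ y ∈ Subgroup.closure S, Commute x y := by
    intro x hx y hy
    have : Subgroup.closure S ≤ Subgroup.centralizer {x} := by
      rw [Subgroup.closure_le]
      intro z hz
      exact Subgroup.mem_centralizer_singleton_iff.2 (h1 x hx z hz).symm
    exact (Subgroup.mem_centralizer_singleton_iff.1 (this hy)).symm
  have h3 : ∀ x ∈ Subgroup.closure S, x ^ p = 1 := by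
    intro x hx
    induction hx using Subgroup.closure_induction with
    | mem x hx => exact hp x hx
    | one => exact one_pow p
    | mul x y hx hy ihx ihy => rw [(h2 x hx y hy).mul_pow, ihx, ihy, one_mul]
    | inv x hx ih => rw [inv_pow, ih, inv_one]
  rintro ⟨x, hx⟩
  exact ⟨1, Subtype.ext (by simpa using h3 x hx)⟩

/-- In an `s.card`-transitive group, any permutation is realised on the finite set `s`. -/
theorem exists_mem_eqOn_of_isMultiplyPretransitive {G : Subgroup (Perm α)} (s : Finset α)
    (hG : MulAction.IsMultiplyPretransitive G α s.card) (π : Perm α) :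
    ∃ h ∈ G, ∀ x ∈ s, h x = π x := by
  let e : Fin s.card ↪ α := s.equivFin.symm.toEmbedding.trans (Function.Embedding.subtype _)
  obtain ⟨h, hh⟩ := hG.exists_smul_eq e (e.trans π.toEmbedding)
  refine ⟨h, h.2, fun x hx => ?_⟩
  have := DFunLike.congr_fun hh (s.equivFin ⟨x, hx⟩)
  simpa [e, Subgroup.smul_def] using this

section Cycles

variable {α : Type*} [Fintype α] [DecidableEq α]

/-- If `p` does not divide the index of `G`, then `G` contains `k` disjoint `p`-cycles whenever
there is room for them. -/
theorem exists_cycleFactors_mem {p k : ℕ} [hp : Fact p.Prime] {G : Subgroup (Perm α)}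
    (h : ¬ p ∣ G.index) (hk : k * p ≤ Fintype.card α) :
    ∃ τ : Perm α, τ.cycleType = Multiset.replicate k p ∧ ∀ c ∈ τ.cycleFactorsFinset, c ∈ G := by
  obtain ⟨τ, hτ⟩ : ∃ τ : Perm α, τ.cycleType = Multiset.replicate k p := by
    rw [Perm.exists_with_cycleType_iff]
    refine ⟨by simpa using hk, fun a ha => ?_⟩
    rw [Multiset.eq_of_mem_replicate ha]
    exact hp.out.two_le
  have hQ : IsPGroup p (Subgroup.closure (τ.cycleFactorsFinset : Set (Perm α))) := by
    refine isPGroup_closure_of_commute ?_ ?_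
    · intro x hx y hy
      by_cases hxy : x = y
      · exact hxy ▸ Commute.refl x
      · exact τ.cycleFactorsFinset_mem_commute hx hy hxy
    · intro x hx
      have hc := (Perm.mem_cycleFactorsFinset_iff.1 hx).1
      have : x.support.card ∈ τ.cycleType := by
        rw [Perm.cycleType_def]
        exact Multiset.mem_map_of_mem _ hx
      rw [hτ] at this
      rw [← Multiset.eq_of_mem_replicate this, ← hc.orderOf, pow_orderOf_eq_one]
  obtain ⟨g, hg⟩ := exists_conj_mem_of_isPGroup hQ h
  refine ⟨g * τ * g⁻¹, by rw [Perm.cycleType_conj, hτ], fun c hc => ?_⟩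
  have h1 := hg (g⁻¹ * c * g) (Subgroup.subset_closure ?_)
  · simpa [mul_assoc] using h1
  · have := (Perm.mem_cycleFactorsFinset_conj (g * τ * g⁻¹) g⁻¹ c).2 hc
    simpa [mul_assoc] using this

theorem exists_isCycle_mem {p : ℕ} [hp : Fact p.Prime] {G : Subgroup (Perm α)}
    (h : ¬ p ∣ G.index) (hk : p ≤ Fintype.card α) :
    ∃ g ∈ G, g.IsCycle ∧ g.support.card = p := by
  obtain ⟨τ, hτ, hG⟩ := exists_cycleFactors_mem (k := 1) h (by simpa using hk)
  have hc : τ.IsCycle := by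
    rw [← Perm.card_cycleType_eq_one, hτ]
    simp
  refine ⟨τ, hG τ ?_, hc, ?_⟩
  · rw [Perm.cycleFactorsFinset_eq_singleton_self_iff.2 hc]
    simp
  · rw [← Perm.sum_cycleType, hτ]
    simp

/-- Two `p`-cycles of `G` with the same support generate conjugate subgroups, and the conjugating
element may be chosen to be trivial outside the support. -/
theorem exists_conj_mem_zpowers {p : ℕ} [hp : Fact p.Prime] {G : Subgroup (Perm α)}
    {g g' : Perm α} (hg : g ∈ G) (hg' : g' ∈ G) (hc : g.IsCycle) (hgp : g.support.card = p)
    (hgp' : g' ^ p = 1) (hs : g'.support = g.support) :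
    ∃ k ∈ G, (∀ x ∉ g.support, k x = x) ∧ k * g' * k⁻¹ ∈ Subgroup.zpowers g := by
  set f : Perm g.support →* Perm α := Perm.ofSubtype with hf
  have lift : ∀ x : Perm α, x.support ⊆ g.support → ∃ y, f y = x := by
    intro x hx
    have h1 : ∀ a, x a ∈ g.support ↔ a ∈ g.support := by
      intro a
      by_cases ha : x a = a
      · rw [ha]
      · exact iff_of_true (hx (Perm.apply_mem_support.2 (Perm.mem_support.2 ha)))
          (hx (Perm.mem_support.2 ha))
    exact ⟨x.subtypePerm h1, Perm.ofSubtype_subtypePerm _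
      fun a ha => hx (Perm.mem_support.2 ha)⟩
  obtain ⟨y, hy⟩ := lift g subset_rfl
  obtain ⟨y', hy'⟩ := lift g' hs.subset
  have finj : Function.Injective f := Perm.ofSubtype_injective
  set K : Subgroup (Perm g.support) := G.comap f with hK
  have hyK : y ∈ K := by simpa [hK, hy] using hg
  have hyK' : y' ∈ K := by simpa [hK, hy'] using hg'
  have hyo : orderOf y = p := by
    rw [← orderOf_injective f finj, hy, hc.orderOf, hgp]
  let Z : Subgroup K := Subgroup.zpowers ⟨y, hyK⟩
  have hZc : Nat.card Z = p := by
    rw [Nat.card_zpowers, Subgroup.orderOf_mk, hyo]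
  -- `K` is `G` intersected with the symmetric group on the support, and `p ^ 2` does not divide
  -- `p!`; so `Z` is a Sylow subgroup of `K`.
  have hidx : ¬ p ∣ Z.index := by
    intro hd
    have h1 : p * p ∣ Nat.card K := by
      rw [← Z.card_mul_index, hZc]
      exact Nat.mul_dvd_mul_left p hd
    have h2 : p * p ∣ p ! := by
      refine h1.trans ((Subgroup.card_subgroup_dvd_card K).trans ?_)
      rw [Nat.card_eq_fintype_card, Fintype.card_perm, Fintype.card_coe, hgp]
    have hp1 := hp.out.pos
    obtain ⟨q, rfl⟩ := Nat.exists_eq_add_of_le' hp1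
    rw [Nat.factorial_succ] at h2
    have h3 := (hp.out.dvd_factorial).1 (Nat.dvd_of_mul_dvd_mul_left hp1 h2)
    omega
  have hQ : IsPGroup p (Subgroup.zpowers (⟨y', hyK'⟩ : K)) := by
    rw [Subgroup.zpowers_eq_closure]
    refine isPGroup_closure_of_commute ?_ ?_
    · rintro _ rfl _ rfl
      exact Commute.refl _
    · rintro _ rfl
      apply Subtype.ext
      apply finj
      simp [hy', hgp']
  obtain ⟨k, hk⟩ := exists_conj_mem_of_isPGroup hQ hidx
  refine ⟨f k, k.2, ?_, ?_⟩
  · intro x hx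
    exact Perm.ofSubtype_apply_of_not_mem _ hx
  · have h1 := hk _ (Subgroup.mem_zpowers _)
    obtain ⟨i, hi⟩ := Subgroup.mem_zpowers_iff.1 h1
    refine Subgroup.mem_zpowers_iff.2 ⟨i, ?_⟩
    have h2 := congrArg (fun z : K => f (z : Perm g.support)) hi
    simpa [hy, hy'] using h2

/-- **Jordan**: a primitive group of degree `n` containing a `p`-cycle, with `p ≤ n - 3` prime,
contains the alternating group. -/
theorem alternatingGroup_le_of_isPreprimitive_of_isCycle_mem {G : Subgroup (Perm α)}
    (hG : MulAction.IsPreprimitive G α) {p : ℕ} [hp : Fact p.Prime]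
    (hp3 : p + 3 ≤ Fintype.card α) {g : Perm α} (hgc : g.IsCycle) (hgp : g.support.card = p)
    (hg : g ∈ G) : alternatingGroup α ≤ G := by
  by_cases hp_three : p = 3
  · refine Perm.alternatingGroup_le_of_isPreprimitive_of_isThreeCycle_mem hG (g := g) ?_ hg
    rw [← card_support_eq_three_iff, hgp, hp_three]
  set s : Finset α := g.supportᶜ with hs
  have hscard : s.card = Fintype.card α - p := by rw [hs, Finset.card_compl, hgp]
  have hmem : ∀ x, x ∈ s ↔ g x = x := by intro x; simp [hs]
  -- The fixator of `s` is transitive on the `p` remaining points, hence primitive there since `p`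
  -- is prime. This makes the primitive group `G` even `(s.card + 1)`-transitive, a number written
  -- `s.card - 1 + 2` below.
  have htrans : MulAction.IsMultiplyPretransitive G α s.card := by
    have h1 : MulAction.IsMultiplyPreprimitive G α (s.card - 1 + 2) := by
      apply hG.isMultiplyPreprimitive (s := (g.supportᶜ : Set α))
      · rw [← Finset.coe_compl, Set.ncard_coe_finset, ← hs]
        omega
      · rw [Nat.card_eq_fintype_card]
        have := hp.out.two_le
        omega
      have := Perm.isPretransitive_of_isCycle_mem hgc hg
      apply MulAction.IsPreprimitive.of_prime_card
      classical
      convert! hp.out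
      rw [← hgp, Nat.card_eq_fintype_card, Fintype.card_subtype]
      apply congr_arg
      ext x
      simp [SubMulAction.mem_ofFixingSubgroup_iff]
    have h2 : MulAction.IsMultiplyPretransitive G α (s.card - 1 + 2) :=
      MulAction.IsMultiplyPreprimitive.isMultiplyPretransitive ..
    have := hp.out.two_le
    refine MulAction.isMultiplyPretransitive_of_le (n := s.card - 1 + 2) (by omega) ?_
    rw [Nat.card_eq_fintype_card]
    omega
  have gp : g ^ p = 1 := by rw [← hgp, ← hgc.orderOf, pow_orderOf_eq_one]
  -- Frattini argument: the normaliser of `⟨g⟩` in `G` induces every permutation of the fixed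
  -- points. Multiple transitivity realises `π` by some `h`; then `g` and its conjugate by `h` have
  -- the same support, and `k`, trivial on `s`, corrects `h`.
  have lift : ∀ π : Perm α, (∀ x ∈ s, π x ∈ s) → ∃ h ∈ G, (∀ x ∈ s, h x = π x) ∧
      h * g * h⁻¹ ∈ Subgroup.zpowers g := by
    intro π hπ
    obtain ⟨h, hhG, hh⟩ := exists_mem_eqOn_of_isMultiplyPretransitive s htrans π
    have himg : ∀ x, h x ∈ s ↔ x ∈ s := by
      have h1 : s.image h = s := by
        apply Finset.eq_of_subset_of_card_le
        · intro y hy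
          obtain ⟨x, hx, rfl⟩ := Finset.mem_image.1 hy
          rw [hh x hx]
          exact hπ x hx
        · rw [Finset.card_image_of_injective _ h.injective]
      intro x
      conv_lhs => rw [← h1]
      rw [Finset.mem_image]
      exact ⟨fun ⟨y, hy, hxy⟩ => h.injective hxy ▸ hy, fun hx => ⟨x, hx, rfl⟩⟩
    have hsupp : (h * g * h⁻¹).support = g.support := by
      ext x
      rw [← not_iff_not]
      have h1 : x ∉ (h * g * h⁻¹).support ↔ h⁻¹ x ∈ s := by
        rw [hmem, Perm.notMem_support, Perm.mul_apply, Perm.mul_apply]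
        rw [← Perm.eq_inv_iff_eq]
      have h2 : x ∉ g.support ↔ x ∈ s := by rw [hmem, Perm.notMem_support]
      rw [h1, h2, ← himg]
      simp
    obtain ⟨k, hkG, hk, hkz⟩ := exists_conj_mem_zpowers (p := p) hg
      (G.mul_mem (G.mul_mem hhG hg) (G.inv_mem hhG)) hgc hgp
      (by rw [conj_pow, gp]; simp) hsupp
    refine ⟨k * h, G.mul_mem hkG hhG, fun x hx => ?_, by simpa [mul_assoc] using hkz⟩
    rw [Perm.mul_apply, ← hh x hx]
    apply hk
    have := (himg x).2 hx
    rwa [hmem, ← Perm.notMem_support] at this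
  obtain ⟨a, b, c, has, hbs, hcs, hab, hac, hbc⟩ : ∃ a b c, a ∈ s ∧ b ∈ s ∧ c ∈ s ∧
      a ≠ b ∧ a ≠ c ∧ b ≠ c := by
    have : 2 < s.card := by omega
    obtain ⟨a, b, c, h⟩ := Finset.two_lt_card_iff.1 this
    exact ⟨a, b, c, h⟩
  have hswap : ∀ u v, u ∈ s → v ∈ s → ∀ x ∈ s, swap u v x ∈ s := by
    intro u v hu hv x hx
    rw [swap_apply_def]
    split_ifs <;> assumption
  -- The automorphism group of `⟨g⟩` is abelian, so the commutator of `X` and `Y` centralises `g`,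
  -- while on `s` it is the commutator of two overlapping transpositions, a 3-cycle.
  obtain ⟨X, hXG, hX, hXg⟩ := lift (swap a b) (hswap a b has hbs)
  obtain ⟨Y, hYG, hY, hYg⟩ := lift (swap b c) (hswap b c hbs hcs)
  set t : Perm α := swap b a * swap b c * (swap b a * swap b c) with ht
  set z : Perm α := X⁻¹ * Y⁻¹ * X * Y with hz
  have hzG : z ∈ G := G.mul_mem (G.mul_mem (G.mul_mem (G.inv_mem hXG) (G.inv_mem hYG)) hXG) hYG
  have inv_eq : ∀ W : Perm α, ∀ u v, u ∈ s → v ∈ s → (∀ x ∈ s, W x = swap u v x) →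
      ∀ x ∈ s, W⁻¹ x = swap u v x := by
    intro W u v hu hv hW x hx
    rw [Perm.inv_eq_iff_eq, hW _ (hswap u v hu hv x hx), swap_apply_self]
  have hts : ∀ x ∈ s, t x ∈ s := by
    intro x hx
    rw [ht, swap_comm b a]
    exact hswap a b has hbs _ (hswap b c hbs hcs _ (hswap a b has hbs _ (hswap b c hbs hcs _ hx)))
  have hzs : ∀ x ∈ s, z x = t x := by
    intro x hx
    have h1 := hswap b c hbs hcs _ hx
    have h2 := hswap a b has hbs _ h1
    have h3 := hswap b c hbs hcs _ h2
    rw [hz, ht, swap_comm b a]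
    simp only [Perm.mul_apply]
    rw [hY x hx, hX _ h1, inv_eq Y b c hbs hcs hY _ h2, inv_eq X a b has hbs hX _ h3]
  have hzg : Commute z g := by
    obtain ⟨i, hi⟩ := Subgroup.mem_zpowers_iff.1 hXg
    obtain ⟨j, hj⟩ := Subgroup.mem_zpowers_iff.1 hYg
    have h1 : X * Y * g * (X * Y)⁻¹ = g ^ (i * j) := by
      have : X * Y * g * (X * Y)⁻¹ = X * (Y * g * Y⁻¹) * X⁻¹ := by group
      rw [this, ← hj, ← conj_zpow, ← hi, zpow_mul]
    have h2 : Y * X * g * (Y * X)⁻¹ = g ^ (i * j) := by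
      have : Y * X * g * (Y * X)⁻¹ = Y * (X * g * X⁻¹) * Y⁻¹ := by group
      rw [this, ← hi, ← conj_zpow, ← hj, ← zpow_mul, mul_comm]
    have h3 : X * Y * g * (X * Y)⁻¹ = Y * X * g * (Y * X)⁻¹ := h1.trans h2.symm
    have h4 : z * g * z⁻¹ = g := by
      have : z * g * z⁻¹ = (Y * X)⁻¹ * (X * Y * g * (X * Y)⁻¹) * (Y * X) := by
        rw [hz]; group
      rw [this, h3]; group
    exact mul_inv_eq_iff_eq_mul.1 h4
  obtain ⟨x₀, hx₀, hcyc⟩ := hgc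
  have hzx₀ : g (z x₀) ≠ z x₀ := by
    intro h
    apply hx₀
    have : z (g x₀) = z x₀ := by
      rw [← Perm.mul_apply, hzg.eq, Perm.mul_apply, h]
    exact z.injective this
  obtain ⟨k, hk⟩ := hcyc hzx₀
  -- What commutes with a cycle acts on its support as a power of it; so the `p`-th power of `z` is
  -- trivial there.
  have hzsupp : ∀ x, x ∉ s → z x = (g ^ k) x := by
    intro x hx
    rw [hmem] at hx
    obtain ⟨i, rfl⟩ := hcyc hx
    rw [← Perm.mul_apply, (hzg.zpow_right i).eq, Perm.mul_apply, ← hk, ← Perm.mul_apply,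
      ← Perm.mul_apply, ← zpow_add, ← zpow_add, add_comm]
  have hpow_s : ∀ i : ℕ, ∀ x ∈ s, (z ^ i) x = (t ^ i) x ∧ (t ^ i) x ∈ s := by
    intro i x hx
    induction i with
    | zero => simpa using hx
    | succ i ih =>
      rw [pow_succ', pow_succ', Perm.mul_apply z, Perm.mul_apply t, ih.1, hzs _ ih.2]
      exact ⟨rfl, hts _ ih.2⟩
  have hpow_supp : ∀ i : ℕ, ∀ x, x ∉ s → (z ^ i) x = ((g ^ k) ^ i) x := by
    intro i x hx
    induction i with
    | zero => simp
    | succ i ih =>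
      rw [pow_succ', pow_succ', Perm.mul_apply z, Perm.mul_apply (g ^ k), ih, hzsupp]
      rw [hmem] at hx ⊢
      intro h
      apply hx
      rw [← zpow_natCast, ← zpow_mul] at h
      have : (g ^ (k * (i : ℤ))) (g x) = (g ^ (k * (i : ℤ))) x := by
        rw [← Perm.mul_apply, ((Commute.refl g).zpow_left _).eq, Perm.mul_apply, h]
      exact (g ^ (k * (i : ℤ))).injective this
  have htfix : ∀ x, x ∉ s → (t ^ p) x = x := by
    intro x hx
    have h1 : ∀ u v, u ∈ s → v ∈ s → swap u v x = x := fun u v hu hv =>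
      swap_apply_of_ne_of_ne (fun h => hx (h ▸ hu)) (fun h => hx (h ▸ hv))
    have : t x = x := by
      rw [ht]
      simp only [Perm.mul_apply]
      rw [h1 b c hbs hcs, h1 b a hbs has, h1 b c hbs hcs, h1 b a hbs has]
    exact (Function.IsFixedPt.perm_pow this p)
  have hzt : z ^ p = t ^ p := by
    ext x
    by_cases hx : x ∈ s
    · exact (hpow_s p x hx).1
    · rw [hpow_supp p x hx, htfix x hx, ← zpow_natCast, ← zpow_mul, mul_comm, zpow_mul,
        zpow_natCast, gp, one_zpow, Perm.one_apply]
  have ht3 : t.IsThreeCycle :=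
    (Perm.isThreeCycle_swap_mul_swap_same hab.symm hbc hac).isThreeCycle_sq
  -- This is where `p ≠ 3` is needed: otherwise the power would be trivial.
  have htp : (t ^ p).IsThreeCycle := by
    have h3 : p % 3 = 1 ∨ p % 3 = 2 := by
      have : ¬ 3 ∣ p := fun h => hp_three
        ((Nat.prime_dvd_prime_iff_eq Nat.prime_three hp.out).1 h).symm
      omega
    rw [← pow_mod_orderOf, ht3.orderOf]
    rcases h3 with h3 | h3 <;> rw [h3]
    · simpa using ht3
    · rw [pow_two]
      exact ht3.isThreeCycle_sq
  refine Perm.alternatingGroup_le_of_isPreprimitive_of_isThreeCycle_mem hG htp ?_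
  rw [← hzt]
  exact G.pow_mem hzG p

end Cycles

end DerangementProportion

namespace DerangementProportion
open Equiv MulAction

/-! ### Transitivity -/

theorem choose_dvd_index {α : Type*} [Fintype α] [DecidableEq α] {H : Subgroup (Perm α)}
    (s : Finset α) (h : ∀ g ∈ H, ∀ x ∈ s, g x ∈ s) :
    (Fintype.card α).choose s.card ∣ H.index := by
  let s' : Set.powersetCard α s.card := ⟨s, rfl⟩
  have h1 : H ≤ stabilizer (Perm α) s' := by
    intro g hg
    rw [mem_stabilizer_iff]
    apply Subtype.ext
    rw [Set.powersetCard.coe_smul]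
    apply Finset.eq_of_subset_of_card_le
    · intro x hx
      obtain ⟨y, hy, rfl⟩ := Finset.mem_smul_finset.1 hx
      exact h g hg y hy
    · rw [Finset.card_smul_finset]
  have h2 : (stabilizer (Perm α) s').index = (Fintype.card α).choose s.card := by
    have : IsPretransitive (Perm α) (Set.powersetCard α s.card) :=
      Set.powersetCard.isPretransitive
    rw [index_stabilizer_of_transitive, Set.powersetCard.card, Nat.card_eq_fintype_card]
  rw [← h2]
  exact Subgroup.index_dvd_of_le h1

/-- From `k * n.choose k = n * (n-1).choose (k-1)`, the number `n / gcd n k` divides the binomial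
coefficient. It also divides `n`, hence divides 2; since `k < n` it equals 2, and then `k` is the
gcd. -/
theorem eq_two_mul_of_choose_dvd_E {n k : ℕ} (hk : 0 < k) (hkn : k < n)
    (h : ((n.choose k : ℕ) : ℤ) ∣ E n) : n = 2 * k := by
  obtain ⟨n, rfl⟩ := Nat.exists_eq_add_of_le' (show 1 ≤ n by omega)
  obtain ⟨k, rfl⟩ := Nat.exists_eq_add_of_le' (show 1 ≤ k from hk)
  set g := (n + 1).gcd (k + 1) with hg
  have hgpos : 0 < g := Nat.gcd_pos_of_pos_left _ (by omega)
  obtain ⟨u, hu⟩ : g ∣ n + 1 := Nat.gcd_dvd_left _ _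
  obtain ⟨v, hv⟩ : g ∣ k + 1 := Nat.gcd_dvd_right _ _
  have hco : Nat.Coprime u v := by
    have := Nat.coprime_div_gcd_div_gcd (m := n + 1) (n := k + 1) hgpos
    rwa [← hg, hu, hv, Nat.mul_div_cancel_left _ hgpos, Nat.mul_div_cancel_left _ hgpos] at this
  have h1 : u * n.choose k = (n + 1).choose (k + 1) * v := by
    have h2 := Nat.add_one_mul_choose_eq n k
    nth_rewrite 1 [hu] at h2
    nth_rewrite 2 [hv] at h2
    have : g * (u * n.choose k) = g * ((n + 1).choose (k + 1) * v) := by linarith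
    exact Nat.eq_of_mul_eq_mul_left hgpos this
  have h3 : u ∣ (n + 1).choose (k + 1) :=
    hco.dvd_of_dvd_mul_right (h1 ▸ Dvd.intro _ rfl)
  have h4 : u ∣ 2 := dvd_two_of_dvd_E (by omega) ((Int.natCast_dvd_natCast.2 h3).trans h)
    (hu ▸ Dvd.intro_left _ rfl)
  have hv0 : 0 < v := by
    rcases Nat.eq_zero_or_pos v with h | h
    · rw [h] at hv; omega
    · exact h
  rcases (Nat.dvd_prime Nat.prime_two).1 h4 with h5 | h5
  · subst h5
    nlinarith
  · subst h5
    have : v < 2 := by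
      by_contra hcon
      nlinarith
    have hv1 : v = 1 := by omega
    subst hv1
    omega

/-- An odd common divisor of `2k - 3` and `E (2k)` divides 4, so `2k - 3` is prime to the binomial
coefficient. But `2k - 3` divides `k (k-1)` times that coefficient, hence divides `k (k-1)`, hence
3. The factor 2 in the hypothesis serves the case of two blocks, whose stabiliser has twice the
index of `G`. -/
theorem le_three_of_centralBinom_dvd {k : ℕ} (hk : 2 ≤ k)
    (h : (((2 * k).choose k : ℕ) : ℤ) ∣ 2 * E (2 * k)) : k ≤ 3 := by
  obtain ⟨k, rfl⟩ := Nat.exists_eq_add_of_le' hk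
  -- the index is `k + 2`; the odd number `2 * k + 1` is coprime to the binomial coefficient
  have hco : Nat.Coprime (2 * k + 1) ((2 * (k + 2)).choose (k + 2)) := by
    set d := (2 * k + 1).gcd ((2 * (k + 2)).choose (k + 2)) with hd
    have h1 : d ∣ 2 * k + 1 := Nat.gcd_dvd_left _ _
    have hodd : Nat.Coprime d 2 :=
      Nat.Coprime.coprime_dvd_left h1 (by simp)
    have h2 : (d : ℤ) ∣ 2 * E (2 * (k + 2)) :=
      (Int.natCast_dvd_natCast.2 (Nat.gcd_dvd_right _ _)).trans h
    have h3 : (d : ℤ) ∣ E (2 * (k + 2)) :=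
      (Nat.isCoprime_iff_coprime.2 hodd).dvd_of_dvd_mul_left h2
    have h4 : d ∣ 4 := dvd_four_of_dvd_E (by omega) h3 (by
      rwa [show 2 * (k + 2) - 3 = 2 * k + 1 by omega])
    exact Nat.eq_one_of_dvd_coprimes (a := 4) (b := d) ((hodd.pow_right 2).symm) h4 dvd_rfl
  have e1 := Nat.succ_mul_centralBinom_succ k
  have e2 := Nat.succ_mul_centralBinom_succ (k + 1)
  have h5 : (2 * k + 1) ∣ ((k + 2) * (k + 1)) * (2 * (k + 2)).choose (k + 2) := by
    refine ⟨4 * (2 * k + 3) * k.centralBinom, ?_⟩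
    have e3 : (k + 2).centralBinom = (2 * (k + 2)).choose (k + 2) := rfl
    rw [← e3]
    calc (k + 2) * (k + 1) * (k + 2).centralBinom
        = (k + 1) * ((k + 1 + 1) * (k + 1 + 1).centralBinom) := by ring
      _ = 2 * (2 * (k + 1) + 1) * ((k + 1) * (k + 1).centralBinom) := by rw [e2]; ring
      _ = _ := by rw [e1]; ring
  have h6 : (2 * k + 1) ∣ (k + 2) * (k + 1) := hco.dvd_of_dvd_mul_right h5
  have h7 : (2 * k + 1) ∣ 3 := by
    have h8 : (2 * k + 1) ∣ 4 * ((k + 2) * (k + 1)) := h6.mul_left 4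
    have h9 : 4 * ((k + 2) * (k + 1)) = (2 * k + 1) * (2 * k + 5) + 3 := by ring
    rw [h9] at h8
    exact (Nat.dvd_add_right (Dvd.intro _ rfl)).1 h8
  have := Nat.le_of_dvd (by norm_num) h7
  omega

/-- If the index of an intransitive group divides `E n`, then `n = 2k` and the group
stabilises a `k`-set. -/
theorem exists_invariant_of_not_isPretransitive {n : ℕ} {G : Subgroup (Perm (Fin n))}
    (h : (G.index : ℤ) ∣ E n) (hG : ¬ IsPretransitive G (Fin n)) :
    ∃ s : Finset (Fin n), 0 < s.card ∧ n = 2 * s.card ∧ (∀ g ∈ G, ∀ x ∈ s, g x ∈ s) ∧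
      n.choose s.card ∣ G.index := by
  classical
  obtain ⟨a, b, hab⟩ : ∃ a b : Fin n, b ∉ orbit G a := by
    by_contra hcon
    push Not at hcon
    exact hG ⟨fun x y => hcon x y⟩
  let s : Finset (Fin n) := Finset.univ.filter (· ∈ orbit G a)
  have hs : ∀ g ∈ G, ∀ x ∈ s, g x ∈ s := by
    intro g hg x hx
    simp only [s, Finset.mem_filter, Finset.mem_univ, true_and] at hx ⊢
    obtain ⟨u, rfl⟩ := hx
    exact ⟨⟨g, hg⟩ * u, mul_smul _ _ _⟩
  have hpos : 0 < s.card := Finset.card_pos.2 ⟨a, by simp [s]⟩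
  have hlt : s.card < n := by
    have : s.card < (Finset.univ : Finset (Fin n)).card :=
      Finset.card_lt_card (Finset.ssubset_univ_iff.2 fun h => hab (by
        have : b ∈ s := h ▸ Finset.mem_univ b
        simpa [s] using this))
    simpa using this
  have hd : n.choose s.card ∣ G.index := by simpa using choose_dvd_index s hs
  exact ⟨s, hpos, eq_two_mul_of_choose_dvd_E hpos hlt ((Int.natCast_dvd_natCast.2 hd).trans h),
    hs, hd⟩

theorem isPretransitive_of_index_dvd {n : ℕ} (hn : 7 ≤ n) {G : Subgroup (Perm (Fin n))}
    (h : (G.index : ℤ) ∣ E n) : IsPretransitive G (Fin n) := by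
  by_contra hG
  obtain ⟨s, hpos, hs, -, hd⟩ := exists_invariant_of_not_isPretransitive h hG
  have : s.card ≤ 3 := by
    apply le_three_of_centralBinom_dvd (by omega)
    rw [← hs]
    exact ((Int.natCast_dvd_natCast.2 hd).trans h).mul_left 2
  omega

/-! ### Blocks of imprimitivity and disjoint `p`-cycles -/

theorem card_filter_fixed_modEq {α : Type*} [DecidableEq α] {p : ℕ} [Fact p.Prime]
    {τ : Perm α} (hτ : τ ^ p = 1)
    (D : Finset α) (hD : ∀ x ∈ D, τ x ∈ D) :
    (D.filter (fun x => τ x = x)).card ≡ D.card [MOD p] := by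
  have himg : ∀ x, τ x ∈ D ↔ x ∈ D := by
    have h1 : D.image τ = D := by
      apply Finset.eq_of_subset_of_card_le
      · intro y hy
        obtain ⟨x, hx, rfl⟩ := Finset.mem_image.1 hy
        exact hD x hx
      · rw [Finset.card_image_of_injective _ τ.injective]
    intro x
    conv_lhs => rw [← h1]
    rw [Finset.mem_image]
    exact ⟨fun ⟨y, hy, hxy⟩ => τ.injective hxy ▸ hy, fun hx => ⟨x, hx, rfl⟩⟩
  let σ : Perm D := τ.subtypePerm himg
  have hσ : σ ^ p ^ 1 = 1 := by
    rw [pow_one]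
    ext x
    simp [σ, hτ]
  have h := Perm.card_compl_support_modEq hσ
  rw [Fintype.card_coe] at h
  convert h using 1
  apply Finset.card_bij (fun x hx => (⟨x, (Finset.mem_filter.1 hx).1⟩ : D))
  · intro x hx
    simp [σ, (Finset.mem_filter.1 hx).2]
  · intro x hx y hy hxy
    simpa using hxy
  · rintro ⟨x, hx⟩ h
    refine ⟨x, ?_, rfl⟩
    simpa [σ, Subtype.ext_iff, hx] using h

section Blocks

variable {α : Type*} [Fintype α] [DecidableEq α] {G : Subgroup (Perm α)}

/-- A cycle of prime length fixes every block with at least two points. -/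
theorem smul_block_eq_of_isCycle {p : ℕ} (hp : p.Prime) {B : Set α} (hB : IsBlock G B)
    (hnt : B.Nontrivial) {c : Perm α} (hcG : c ∈ G) (hc : c.IsCycle)
    (hcp : c.support.card = p) : ∀ x ∈ B, c x ∈ B := by
  have key : ∀ d ∈ G, ∀ x ∈ B, d x ∈ B → ∀ y ∈ B, d y ∈ B := by
    intro d hd x hx hdx y hy
    have h1 : (⟨d, hd⟩ : G) • B = B := isBlock_iff_smul_eq_of_mem.1 hB hx hdx
    rw [← h1]
    exact Set.smul_mem_smul_set hy
  by_contra hcon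
  push Not at hcon
  obtain ⟨z, hz, hcz⟩ := hcon
  -- A block moved off itself contains no fixed point of `c`, so two of its points are joined by a
  -- power `c ^ i` with `i` prime to `p`. That power preserves `B` and generates `⟨c⟩`.
  have hmove : ∀ x ∈ B, c x ≠ x := by
    intro x hx hfix
    exact hcz (key c hcG x hx (hfix.symm ▸ hx) z hz)
  obtain ⟨x, hx, y, hy, hxy⟩ := hnt
  obtain ⟨i, hi⟩ := hc.exists_pow_eq (hmove x hx) (hmove y hy)
  have hpB : ∀ w ∈ B, (c ^ i) w ∈ B := key _ (G.pow_mem hcG i) x hx (hi ▸ hy)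
  have hco : Nat.Coprime i p := by
    refine ((Nat.Prime.coprime_iff_not_dvd hp).2 fun hd => hxy ?_).symm
    rw [← hcp, ← hc.orderOf] at hd
    rw [← hi, orderOf_dvd_iff_pow_eq_one.1 hd, Perm.one_apply]
  rw [← hcp, ← hc.orderOf] at hco
  obtain ⟨m, hm⟩ := exists_pow_eq_self_of_coprime hco
  apply hcz
  have : ∀ j : ℕ, ((c ^ i) ^ j) z ∈ B := by
    intro j
    induction j with
    | zero => simpa using hz
    | succ j ih => rw [pow_succ', Perm.mul_apply]; exact hpB _ ih
  simpa [hm] using this m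

/-- If `p` does not divide the index of the transitive group `G`, which has a system of `a` blocks
of size `b > 1`, then the residues of `b` and of the degree modulo `p` are in ratio `a`. -/
theorem ncard_orbit_mul_mod {p : ℕ} [hp : Fact p.Prime] [IsPretransitive G α]
    (h : ¬ p ∣ G.index) {B : Set α} (hB : IsBlock G B) (hnt : B.Nontrivial) :
    (orbit G B).ncard * (B.ncard % p) = Fintype.card α % p := by
  classical
  -- A maximal number of disjoint `p`-cycles leaves exactly `n mod p` fixed points. Each cycle
  -- preserves every block, so every block contains at least `b mod p` of them.
  obtain ⟨τ, hτ, hτG⟩ := exists_cycleFactors_mem (k := Fintype.card α / p) h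
    (Nat.div_mul_le_self _ _)
  have hτp : τ ^ p = 1 := by
    rw [← orderOf_dvd_iff_pow_eq_one, ← Perm.lcm_cycleType, hτ, Multiset.lcm_dvd]
    intro b hb
    rw [Multiset.eq_of_mem_replicate hb]
  have hblocks : ∀ D ∈ orbit G B, ∀ x ∈ D, τ x ∈ D := by
    rintro _ ⟨g, rfl⟩ x hx
    by_cases hfix : τ x = x
    · rwa [hfix]
    · have hmem : τ.cycleOf x ∈ τ.cycleFactorsFinset :=
        Perm.cycleOf_mem_cycleFactorsFinset_iff.2 (Perm.mem_support.2 hfix)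
      have hcard : (τ.cycleOf x).support.card = p := by
        have : (τ.cycleOf x).support.card ∈ τ.cycleType := by
          rw [Perm.cycleType_def]
          exact Multiset.mem_map_of_mem _ hmem
        rw [hτ] at this
        exact Multiset.eq_of_mem_replicate this
      have := smul_block_eq_of_isCycle hp.out (hB.translate g)
        (hnt.image (MulAction.injective g)) (hτG _ hmem)
        (Perm.mem_cycleFactorsFinset_iff.1 hmem).1 hcard x hx
      rwa [Perm.cycleOf_apply_self] at this
  have hsys := (hB.isBlockSystem hnt.nonempty).1
  have hpart : ∀ x : α, ∃! D, D ∈ orbit G B ∧ x ∈ D := hsys.2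
  set F : Finset α := Finset.univ.filter (fun x => τ x = x) with hF
  have hFcard : F.card = Fintype.card α % p := by
    have h1 : F = τ.supportᶜ := by ext x; simp [hF]
    have h2 : τ.support.card = Fintype.card α / p * p := by
      rw [← Perm.sum_cycleType, hτ]; simp
    rw [h1, Finset.card_compl, h2]
    have := Nat.div_add_mod' (Fintype.card α) p
    omega
  have hfin : (orbit G B).Finite := Set.toFinite _
  set O : Finset (Set α) := hfin.toFinset with hO
  have hOcard : O.card = (orbit G B).ncard := (Set.ncard_eq_toFinset_card _ hfin).symm
  have hsum : ∑ D ∈ O, (F.filter (· ∈ D)).card = F.card := by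
    simp only [Finset.card_filter]
    rw [Finset.sum_comm]
    rw [Finset.card_eq_sum_ones]
    refine Finset.sum_congr rfl fun x _ => ?_
    rw [← Finset.card_filter, Finset.card_eq_one]
    obtain ⟨D, ⟨hD1, hD2⟩, hD3⟩ := hpart x
    refine ⟨D, ?_⟩
    ext D'
    simp only [Finset.mem_filter, hO, Set.Finite.mem_toFinset, Finset.mem_singleton]
    exact ⟨fun h => hD3 D' h, fun h => h ▸ ⟨hD1, hD2⟩⟩
  have hle : ∀ D ∈ O, B.ncard % p ≤ (F.filter (· ∈ D)).card := by
    intro D hD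
    have hD' : D ∈ orbit G B := by simpa [hO] using hD
    have hDcard : D.ncard = B.ncard := by
      obtain ⟨g, rfl⟩ := hD'
      exact Set.ncard_smul_set g B
    have h1 := card_filter_fixed_modEq hτp D.toFinset (by
      intro x hx
      rw [Set.mem_toFinset] at hx ⊢
      exact hblocks D hD' x hx)
    have h2 : F.filter (· ∈ D) = D.toFinset.filter (fun x => τ x = x) := by
      ext x; simp [hF, and_comm]
    rw [h2, ← hDcard, Set.ncard_eq_toFinset_card', ← h1]
    exact Nat.mod_le _ _
  have hle2 : (orbit G B).ncard * (B.ncard % p) ≤ Fintype.card α % p := by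
    rw [← hFcard, ← hsum, ← hOcard, ← smul_eq_mul]
    exact Finset.card_nsmul_le_sum _ _ _ hle
  -- Both sides are congruent modulo `p` and, by the inequality, smaller than `p`; so they are
  -- equal.
  have hmod : (orbit G B).ncard * (B.ncard % p) ≡ Fintype.card α % p [MOD p] := by
    have := hB.ncard_block_mul_ncard_orbit_eq hnt.nonempty
    rw [Nat.card_eq_fintype_card] at this
    rw [← this]
    calc (orbit G B).ncard * (B.ncard % p) ≡ (orbit G B).ncard * B.ncard [MOD p] :=
          (Nat.mod_modEq _ _).mul_left _
      _ ≡ _ [MOD p] := by rw [mul_comm]; exact (Nat.mod_modEq _ _).symm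
  have hlt := Nat.mod_lt (Fintype.card α) hp.out.pos
  exact Nat.ModEq.eq_of_lt_of_lt hmod (hle2.trans_lt hlt) hlt

/-- The product is the index in the symmetric group of the stabiliser of `B` in `G`, which preserves
a set of `B.ncard` points. -/
theorem choose_dvd_ncard_orbit_mul_index {B : Set α} :
    (Fintype.card α).choose B.ncard ∣ (orbit G B).ncard * G.index := by
  classical
  let H : Subgroup (Perm α) := (stabilizer G B).map G.subtype
  have h1 : H.index = (orbit G B).ncard * G.index := by
    rw [Subgroup.index_map_subtype, index_stabilizer]
  rw [← h1, Set.ncard_eq_toFinset_card']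
  apply choose_dvd_index
  rintro _ ⟨g, hg, rfl⟩ x hx
  rw [Set.mem_toFinset] at hx ⊢
  have h2 : g • B = B := hg
  rw [← h2]
  exact Set.smul_mem_smul_set hx

end Blocks

end DerangementProportion

namespace DerangementProportion
open Equiv MulAction

/-! ### Arithmetic of `n - 3`, `n - 4`, `n - 5`, and primitivity -/

theorem exists_eq_pow_of_forall_prime_dvd {N q : ℕ} (hN : N ≠ 0)
    (h : ∀ p, p.Prime → p ∣ N → p = q) : ∃ v, N = q ^ v :=
  ⟨_, Nat.eq_prime_pow_of_unique_prime_dvd hN fun hp hd => h _ hp hd⟩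

theorem exists_eq_three_pow {N : ℕ} (hodd : N % 2 = 1)
    (h : ¬ ∃ p, p.Prime ∧ 5 ≤ p ∧ p ∣ N) : ∃ v, N = 3 ^ v := by
  refine exists_eq_pow_of_forall_prime_dvd (by omega) fun p hp hd => ?_
  have h1 : p < 5 := by
    by_contra hcon
    exact h ⟨p, hp, by omega, hd⟩
  have h2 : p ≠ 2 := by rintro rfl; omega
  have h3 : p ≠ 4 := by rintro rfl; exact absurd hp (by norm_num)
  have := hp.two_le
  omega

theorem exists_eq_two_pow {N : ℕ} (hN : N % 3 ≠ 0)
    (h : ¬ ∃ p, p.Prime ∧ 5 ≤ p ∧ p ∣ N) : ∃ v, N = 2 ^ v := by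
  refine exists_eq_pow_of_forall_prime_dvd (by omega) fun p hp hd => ?_
  have h1 : p < 5 := by
    by_contra hcon
    exact h ⟨p, hp, by omega, hd⟩
  have h2 : p ≠ 3 := by rintro rfl; omega
  have h3 : p ≠ 4 := by rintro rfl; exact absurd hp (by norm_num)
  have := hp.two_le
  omega

theorem exists_eq_five_pow {N : ℕ} (hodd : N % 2 = 1) (hN : N % 3 ≠ 0)
    (h : ¬ ∃ p, p.Prime ∧ 7 ≤ p ∧ p ∣ N) : ∃ v, N = 5 ^ v := by
  refine exists_eq_pow_of_forall_prime_dvd (by omega) fun p hp hd => ?_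
  have h1 : p < 7 := by
    by_contra hcon
    exact h ⟨p, hp, by omega, hd⟩
  have h2 : p ≠ 3 := by rintro rfl; omega
  have h2 : p ≠ 2 := by rintro rfl; omega
  have h3 : p ≠ 4 := by rintro rfl; exact absurd hp (by norm_num)
  have h4 : p ≠ 6 := by rintro rfl; exact absurd hp (by norm_num)
  have := hp.two_le
  omega

theorem three_pow_mod_eight (v : ℕ) : 3 ^ v % 8 = 1 ∨ 3 ^ v % 8 = 3 := by
  induction v with
  | zero => simp
  | succ v ih => rw [pow_succ]; omega

theorem five_pow_mod_four (v : ℕ) : 5 ^ v % 4 = 1 := by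
  induction v with
  | zero => simp
  | succ v ih => rw [pow_succ]; omega

theorem two_pow_mod_fifteen (v : ℕ) :
    2 ^ v % 15 = 1 ∨ 2 ^ v % 15 = 2 ∨ 2 ^ v % 15 = 4 ∨ 2 ^ v % 15 = 8 := by
  induction v with
  | zero => simp
  | succ v ih => rw [pow_succ]; omega

theorem four_dvd_two_pow {v : ℕ} (h : 4 ≤ 2 ^ v) : 2 ^ v % 4 = 0 := by
  rcases v with _ | _ | v
  · simp at h
  · simp at h
  · rw [pow_succ, pow_succ]; omega

theorem eight_dvd_two_pow {v : ℕ} (h : 5 ≤ 2 ^ v) : 2 ^ v % 8 = 0 := by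
  rcases v with _ | _ | _ | v
  · simp at h
  · simp at h
  · simp at h
  · rw [pow_succ, pow_succ, pow_succ]; omega

theorem three_dvd_three_pow {v : ℕ} (h : 2 ≤ 3 ^ v) : 3 ^ v % 3 = 0 := by
  rcases v with _ | v
  · simp at h
  · rw [pow_succ]; omega

/-- The arithmetic contradiction ruling out a system of `a ≥ 3` blocks of size `b ≥ 2`. -/
theorem false_of_block_numbers {n a b : ℕ} (hn : 7 ≤ n) (hab : b * a = n) (ha : 3 ≤ a)
    (hb : 2 ≤ b) (h3 : (∃ p, p.Prime ∧ 5 ≤ p ∧ p ∣ n - 3) → a ∣ 3)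
    (h4 : (∃ p, p.Prime ∧ 5 ≤ p ∧ p ∣ n - 4) → a ∣ 4)
    (h5 : (∃ p, p.Prime ∧ 7 ≤ p ∧ p ∣ n - 5) → a ∣ 5) : False := by
  have e3 : a ∣ 3 → a = 3 := fun h => by have := Nat.le_of_dvd (by norm_num) h; omega
  have e4 : a ∣ 4 → a = 4 := fun h => by
    have := Nat.le_of_dvd (by norm_num) h
    interval_cases a <;> omega
  have e5 : a ∣ 5 → a = 5 := fun h => by
    have := Nat.le_of_dvd (by norm_num) h
    interval_cases a <;> omega
  rcases Nat.mod_two_eq_zero_or_one n with heven | hodd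
  · by_cases p3 : ∃ p, p.Prime ∧ 5 ≤ p ∧ p ∣ n - 3
    · have ha3 := e3 (h3 p3)
      subst ha3
      by_cases p4 : ∃ p, p.Prime ∧ 5 ≤ p ∧ p ∣ n - 4
      · have := e4 (h4 p4); omega
      -- Here 3 divides `n`, so `n - 4` is a power of 2 and `n - 5` a power of 5: the first gives `n
      -- - 5 ≡ 3` modulo 4, the second 1.
      obtain ⟨x, hx⟩ := exists_eq_two_pow (by omega) p4
      have := four_dvd_two_pow (v := x) (by omega)
      by_cases p5 : ∃ p, p.Prime ∧ 7 ≤ p ∧ p ∣ n - 5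
      · have := e5 (h5 p5); omega
      obtain ⟨z, hz⟩ := exists_eq_five_pow (by omega) (by omega) p5
      have := five_pow_mod_four z
      omega
    · obtain ⟨y, hy⟩ := exists_eq_three_pow (by omega) p3
      have h3n := three_dvd_three_pow (v := y) (by omega)
      by_cases p5 : ∃ p, p.Prime ∧ 7 ≤ p ∧ p ∣ n - 5
      · have ha5 := e5 (h5 p5)
        subst ha5
        by_cases p4 : ∃ p, p.Prime ∧ 5 ≤ p ∧ p ∣ n - 4
        · have := e4 (h4 p4); omega
        -- Now 15 divides `n`, so the power of 2 would be 11 modulo 15.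
        obtain ⟨x, hx⟩ := exists_eq_two_pow (by omega) p4
        have := two_pow_mod_fifteen x
        omega
      · obtain ⟨z, hz⟩ := exists_eq_five_pow (by omega) (by omega) p5
        have := five_pow_mod_four z
        by_cases p4 : ∃ p, p.Prime ∧ 5 ≤ p ∧ p ∣ n - 4
        · have ha4 := e4 (h4 p4)
          subst ha4
          omega
        · obtain ⟨x, hx⟩ := exists_eq_two_pow (by omega) p4
          have := four_dvd_two_pow (v := x) (by omega)
          omega
  · by_cases p4 : ∃ p, p.Prime ∧ 5 ≤ p ∧ p ∣ n - 4
    · have ha4 := e4 (h4 p4)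
      subst ha4
      omega
    obtain ⟨v, hv⟩ := exists_eq_three_pow (by omega) p4
    have h3n := three_dvd_three_pow (v := v) (by omega)
    by_cases p3 : ∃ p, p.Prime ∧ 5 ≤ p ∧ p ∣ n - 3
    · have ha3 := e3 (h3 p3)
      subst ha3
      omega
    obtain ⟨x, hx⟩ := exists_eq_two_pow (by omega) p3
    rcases hn.eq_or_lt with h7 | h8
    · have hle : a ≤ 3 := by nlinarith
      have : a = 3 := by omega
      subst this
      omega
    -- `n - 4` and `n - 3` would be consecutive powers of 3 and 2; but no power of 3 is 7 modulo 8.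
    · have := eight_dvd_two_pow (v := x) (by omega)
      have := three_pow_mod_eight v
      omega

theorem not_dvd_E_of_dvd_sub_three {p n : ℕ} (hp : p.Prime) (hn : 4 ≤ n) (h2 : p ≠ 2)
    (h : p ∣ n - 3) : ¬ (p : ℤ) ∣ E n := fun hd => h2 <|
  (Nat.prime_dvd_prime_iff_eq hp Nat.prime_two).1
    (hp.dvd_of_dvd_pow (n := 2) (dvd_four_of_dvd_E hn hd h))

theorem not_dvd_E_of_dvd_sub_four {p n : ℕ} (hp : p.Prime) (hn : 5 ≤ n) (h5 : 5 ≤ p)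
    (h : p ∣ n - 4) : ¬ (p : ℤ) ∣ E n := fun hd => by
  have h1 : p ∣ 2 * 3 := dvd_six_of_dvd_E hn hd h
  rcases hp.dvd_mul.1 h1 with h1 | h1 <;> have := Nat.le_of_dvd (by norm_num) h1 <;> omega

theorem not_dvd_E_of_dvd_sub_five {p n : ℕ} (hp : p.Prime) (hn : 6 ≤ n) (h5 : 5 ≤ p)
    (h : p ∣ n - 5) : ¬ (p : ℤ) ∣ E n := fun hd => by
  have h1 : p ∣ 2 ^ 4 * 3 := dvd_forty_eight_of_dvd_E hn hd h
  rcases hp.dvd_mul.1 h1 with h1 | h1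
  · have := Nat.le_of_dvd (by norm_num) (hp.dvd_of_dvd_pow h1)
    omega
  · have := Nat.le_of_dvd (by norm_num) h1
    omega

theorem mod_eq_of_dvd_sub {p n r : ℕ} (hr : r ≤ n) (hrp : r < p) (h : p ∣ n - r) :
    n % p = r := by
  obtain ⟨q, hq⟩ := h
  rw [show n = r + p * q by omega, Nat.add_mul_mod_self_left, Nat.mod_eq_of_lt hrp]

theorem not_dvd_index_of_not_dvd_E {p n : ℕ} {G : Subgroup (Perm (Fin n))}
    (h : (G.index : ℤ) ∣ E n) (hp : ¬ (p : ℤ) ∣ E n) : ¬ p ∣ G.index :=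
  fun hd => hp ((Int.natCast_dvd_natCast.2 hd).trans h)

theorem exists_block_of_not_isPreprimitive {H X : Type*} [Group H] [MulAction H X]
    [IsPretransitive H X] (h : ¬ IsPreprimitive H X) :
    ∃ B : Set X, IsBlock H B ∧ B.Nontrivial ∧ B ≠ Set.univ := by
  by_contra hcon
  push Not at hcon
  refine h ⟨fun {B} hB => ?_⟩
  by_cases hs : B.Subsingleton
  · exact Or.inl hs
  · exact Or.inr (hcon B hB (Set.not_subsingleton_iff.1 hs))

theorem isPreprimitive_of_index_dvd {n : ℕ} (hn : 7 ≤ n) {G : Subgroup (Perm (Fin n))}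
    (h : (G.index : ℤ) ∣ E n) : IsPreprimitive G (Fin n) := by
  have htrans := isPretransitive_of_index_dvd hn h
  by_contra hprim
  obtain ⟨B, hB, hnt, huniv⟩ := exists_block_of_not_isPreprimitive hprim
  have hab := hB.ncard_block_mul_ncard_orbit_eq hnt.nonempty
  rw [Nat.card_eq_fintype_card, Fintype.card_fin] at hab
  have hb : 2 ≤ B.ncard := (Set.one_lt_ncard_iff_nontrivial).2 hnt
  have hmod : ∀ p : ℕ, p.Prime → ¬ (p : ℤ) ∣ E n → (orbit G B).ncard * (B.ncard % p) = n % p := by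
    intro p hp hd
    have := Fact.mk hp
    simpa using ncard_orbit_mul_mod (not_dvd_index_of_not_dvd_E h hd) hB hnt
  have hdvd : n.choose B.ncard ∣ (orbit G B).ncard * G.index := by
    simpa using choose_dvd_ncard_orbit_mul_index (G := G) (B := B)
  set a := (orbit G B).ncard with ha
  set b := B.ncard with hb'
  have ha0 : a ≠ 0 := by intro h; rw [h] at hab; omega
  have ha1 : a ≠ 1 := by
    intro h
    rw [h, mul_one] at hab
    exact huniv ((Set.eq_univ_iff_ncard B).2 (by simpa using hab))
  -- The congruence method says nothing useful for two blocks; the binomial divisibility with its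
  -- factor 2 settles them.
  have ha2 : a ≠ 2 := by
    intro h2
    rw [h2] at hdvd hab
    have : b ≤ 3 := by
      apply le_three_of_centralBinom_dvd hb
      rw [show 2 * b = n by omega]
      exact (Int.natCast_dvd_natCast.2 hdvd).trans (by push_cast; exact mul_dvd_mul_left 2 h)
    omega
  refine false_of_block_numbers hn hab (by omega) hb ?_ ?_ ?_
  · rintro ⟨p, hp, h5, hd⟩
    have := hmod p hp (not_dvd_E_of_dvd_sub_three hp (by omega) (by omega) hd)
    rw [mod_eq_of_dvd_sub (r := 3) (by omega) (by omega) hd] at this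
    exact Dvd.intro _ this
  · rintro ⟨p, hp, h5, hd⟩
    have := hmod p hp (not_dvd_E_of_dvd_sub_four hp (by omega) (by omega) hd)
    rw [mod_eq_of_dvd_sub (r := 4) (by omega) (by omega) hd] at this
    exact Dvd.intro _ this
  · rintro ⟨p, hp, h5, hd⟩
    have := hmod p hp (not_dvd_E_of_dvd_sub_five hp (by omega) (by omega) hd)
    rw [mod_eq_of_dvd_sub (r := 5) (by omega) (by omega) hd] at this
    exact Dvd.intro _ this

/-- For even `n` any prime factor of `n - 3` is odd and serves. For odd `n`, if neither `n - 4` nor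
`n - 3` has a prime factor at least 5, they are powers of 3 and of 2 differing by one, impossible
beyond 3 and 4, that is, beyond `n = 7`. -/
theorem exists_prime_not_dvd_E {n : ℕ} (hn : 8 ≤ n) :
    ∃ p : ℕ, p.Prime ∧ p + 3 ≤ n ∧ ¬ (p : ℤ) ∣ E n := by
  rcases Nat.mod_two_eq_zero_or_one n with heven | hodd
  · obtain ⟨p, hp, hd⟩ := Nat.exists_prime_and_dvd (show n - 3 ≠ 1 by omega)
    have := Nat.le_of_dvd (by omega) hd
    refine ⟨p, hp, by omega, not_dvd_E_of_dvd_sub_three hp (by omega) ?_ hd⟩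
    rintro rfl
    omega
  · by_cases p4 : ∃ p, p.Prime ∧ 5 ≤ p ∧ p ∣ n - 4
    · obtain ⟨p, hp, h5, hd⟩ := p4
      have := Nat.le_of_dvd (by omega) hd
      exact ⟨p, hp, by omega, not_dvd_E_of_dvd_sub_four hp (by omega) h5 hd⟩
    by_cases p3 : ∃ p, p.Prime ∧ 5 ≤ p ∧ p ∣ n - 3
    · obtain ⟨p, hp, h5, hd⟩ := p3
      have := Nat.le_of_dvd (by omega) hd
      exact ⟨p, hp, by omega, not_dvd_E_of_dvd_sub_three hp (by omega) (by omega) hd⟩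
    obtain ⟨v, hv⟩ := exists_eq_three_pow (by omega) p4
    have h3n := three_dvd_three_pow (v := v) (by omega)
    obtain ⟨x, hx⟩ := exists_eq_two_pow (by omega) p3
    have := eight_dvd_two_pow (v := x) (by omega)
    have := three_pow_mod_eight v
    omega

theorem eq_alternatingGroup_of_eight_le {n : ℕ} (hn : 8 ≤ n) {G : Subgroup (Perm (Fin n))}
    {g : Perm (Fin n)} (h : (cosetCount G g : ℤ) * G.index = E n) :
    G = alternatingGroup (Fin n) := by
  have hd : (G.index : ℤ) ∣ E n := Dvd.intro_left _ h
  have hprim := isPreprimitive_of_index_dvd (by omega) hd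
  obtain ⟨p, hp, hpn, hpE⟩ := exists_prime_not_dvd_E hn
  have := Fact.mk hp
  obtain ⟨c, hcG, hc, hcp⟩ := exists_isCycle_mem (not_dvd_index_of_not_dvd_E hd hpE)
    (by rw [Fintype.card_fin]; omega)
  exact eq_alternatingGroup_of_le (by omega) h
    (alternatingGroup_le_of_isPreprimitive_of_isCycle_mem hprim (by simpa using hpn) hc hcp hcG)

end DerangementProportion

namespace DerangementProportion
open Equiv MulAction

/-! ### Permutations of seven points coded as octal numbers -/

namespace Seven

/-- The number with octal digits (least significant first) `l`. -/
def codeList (l : List ℕ) : ℕ := l.foldr (fun x a => Nat.add x (Nat.mul 8 a)) 0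

/-- The code of a permutation of seven points: its `i`-th octal digit is the image of `i`. -/
def code (σ : Perm (Fin 7)) : ℕ := codeList (List.ofFn fun i => (σ i : ℕ))

/-- The operations on codes are spelled with `Nat` functions that the kernel evaluates directly on
numerals, because the case checks below are decided there. -/
def digit (p i : ℕ) : ℕ := Nat.mod (Nat.shiftRight p (Nat.mul 3 i)) 8

def comp (p q : ℕ) : ℕ :=
  Nat.add (digit p (digit q 0)) (Nat.mul 8 (Nat.add (digit p (digit q 1)) (Nat.mul 8
  (Nat.add (digit p (digit q 2)) (Nat.mul 8 (Nat.add (digit p (digit q 3)) (Nat.mul 8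
  (Nat.add (digit p (digit q 4)) (Nat.mul 8 (Nat.add (digit p (digit q 5)) (Nat.mul 8
  (Nat.add (digit p (digit q 6)) (Nat.mul 8 0)))))))))))))

def ne (a b : ℕ) : ℕ := Nat.sub 1 (Nat.sub 1 (Nat.xor a b))

def moved (p : ℕ) : ℕ :=
  Nat.add (ne (digit p 0) 0) (Nat.add (ne (digit p 1) 1) (Nat.add (ne (digit p 2) 2)
  (Nat.add (ne (digit p 3) 3) (Nat.add (ne (digit p 4) 4) (Nat.add (ne (digit p 5) 5)
  (ne (digit p 6) 6))))))

/-- The codes of the powers of the cycle `(0 1 2 3 4 5 6)`. -/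
def rots : List ℕ :=
  [1754760, 219345, 289562, 560483, 856492, 1155637, 1455174]

def few (p : ℕ) : Bool := Nat.ble (moved p) 3 && Nat.ble 2 (moved p)

/-- Exponents up to 5 suffice in degree 7: cycle type 5 + 2 yields a transposition at the fifth
power, type 4 + 3 a 3-cycle at the fourth. -/
def fewPow (p : ℕ) : Bool :=
  few p || few (comp p p) || few (comp (comp p p) p) ||
    few (comp (comp p p) (comp p p)) || few (comp (comp (comp p p) p) (comp p p))

def fewCoset (p : ℕ) : Bool := rots.any fun r => fewPow (comp r p)

/-- Multiply on the left by the power of the `7`-cycle that makes `0` a fixed point. -/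
def norm (p : ℕ) : ℕ := comp (rots.getD (Nat.mod (Nat.sub 7 (digit p 0)) 7) 0) p

/-- The codes of the permutations fixing `0`. -/
def stab : List ℕ := ([1, 2, 3, 4, 5, 6] : List ℕ).permutations'.map fun l => codeList (0 :: l)

/-- The multiplications by the nonzero elements of `ℤ/7`. -/
def mults : List ℕ :=
  [1754760, 1416464, 1103256, 993888, 680680, 342384]

/-- The stabiliser of `0` in the automorphism group of the Fano plane with the lines
`{i, i + 1, i + 3}`. -/
def fano : List ℕ :=
  [355040, 416976, 443632, 469224, 572320, 629160, 677768, 705432, 878696, 939120, 969808,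
   993888, 1097040, 1140552, 1152368, 1254232, 1357104, 1401624, 1416464, 1517320, 1620136,
   1677984, 1725080, 1754760]

def isMem (p : ℕ) (T : List ℕ) : Bool := T.any (Nat.beq p)

def adjoin (p : ℕ) (T : List ℕ) : List ℕ := bif isMem p T then T else p :: T

/-- One round of multiplying by `l` with rotations in between; products are normalised so that only
elements fixing 0 are stored. -/
def grow (l : ℕ) (S : List ℕ) : List ℕ :=
  S.foldr (fun a acc => rots.foldr (fun r acc => adjoin (norm (comp (comp a r) l)) acc) acc) S

def full (T : List ℕ) : List ℕ := T.flatMap fun t => rots.map fun r => comp r t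

/-- Whether the permutations coded by `p` and `q` agree nowhere. -/
def apart (p q : ℕ) : Bool :=
  !(Nat.beq (digit p 0) (digit q 0)) && (!(Nat.beq (digit p 1) (digit q 1)) &&
  (!(Nat.beq (digit p 2) (digit q 2)) && (!(Nat.beq (digit p 3) (digit q 3)) &&
  (!(Nat.beq (digit p 4) (digit q 4)) && (!(Nat.beq (digit p 5) (digit q 5)) &&
  !(Nat.beq (digit p 6) (digit q 6)))))))

def distinct : List ℕ → Bool
  | [] => true
  | a :: l => !(isMem a l) && distinct l

/-- The code of `x ↦ -x`. -/
def neg : ℕ := 342384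

/-- Elements of `fano`, each of which generates the group together with the `7`-cycle. -/
def gens : List ℕ := [1517320, 969808, 1677984]

/-- For a group containing the rotations but no transposition or 3-cycle, this confines the
stabiliser of 0 to three sets: multiplications, and the stabilisers in the groups of the Fano plane
and of its mirror image under negation. -/
theorem stab_cases : (stab.all fun p => isMem p mults || isMem p fano ||
    isMem (comp neg (comp p neg)) fano || fewCoset p ||
    rots.any fun r => fewCoset (comp (comp p r) p)) = true := by decide +kernel

theorem fano_reaches_gens : (fano.all fun p => isMem p mults || isMem p gens ||
    rots.any fun r => isMem (norm (comp (comp p r) p)) gens) = true := by decide +kernel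

theorem gens_generate : (gens.all fun e => fano.all fun u =>
    isMem u (grow e (grow e (grow e [e])))) = true := by decide +kernel

/-- The group of the Fano plane cannot be enlarged by the other two kinds of elements without
creating a transposition or a 3-cycle. -/
theorem fano_maximal : (stab.all fun p =>
    !(isMem p mults || isMem (comp neg (comp p neg)) fano) || isMem p fano ||
    fano.any fun t => fewCoset (comp t p)) = true := by decide +kernel

/-- The index 30 would require 1860 / 30 = 62 derangements. Testing `g` that fix 0 and 1 suffices
because the group is 2-transitive. -/
theorem fano_coset_counts : (stab.all fun g => !(Nat.beq (digit g 1) 1) ||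
    !(Nat.beq ((full fano).filter (apart g)).length 62)) = true := by decide +kernel

theorem fano_transitive : ([1, 2, 3, 4, 5, 6].all fun k =>
    fano.any fun t => Nat.beq (digit t k) 1) = true := by decide +kernel

theorem full_fano_distinct : (distinct (full fano) && Nat.beq (full fano).length 168) = true := by
  decide +kernel

theorem rots_eq : ∀ i : Fin 7, rots.getD i 0 = code (finRotate 7 ^ (i : ℕ)) := by decide +kernel

theorem neg_eq : ∃ ν : Perm (Fin 7), code ν = neg ∧ ν * ν = 1 ∧
    ν * finRotate 7 * ν⁻¹ = (finRotate 7)⁻¹ :=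
  ⟨(Equiv.neg (ZMod 7) : Perm (Fin 7)), by decide +kernel, by decide +kernel, by decide +kernel⟩

theorem digit_eq (p i : ℕ) : digit p i = p / 8 ^ i % 8 := by
  change (p >>> (3 * i)) % 8 = _
  rw [Nat.shiftRight_eq_div_pow, pow_mul]
  norm_num

theorem code_eq (σ : Perm (Fin 7)) : code σ = (σ 0 : ℕ) + 8 * ((σ 1 : ℕ) + 8 * ((σ 2 : ℕ) +
    8 * ((σ 3 : ℕ) + 8 * ((σ 4 : ℕ) + 8 * ((σ 5 : ℕ) + 8 * ((σ 6 : ℕ) + 8 * 0)))))) := rfl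

theorem digit_code (σ : Perm (Fin 7)) (i : Fin 7) : digit (code σ) i = σ i := by
  rw [digit_eq, code_eq]
  have h0 := (σ 0).isLt
  have h1 := (σ 1).isLt
  have h2 := (σ 2).isLt
  have h3 := (σ 3).isLt
  have h4 := (σ 4).isLt
  have h5 := (σ 5).isLt
  have h6 := (σ 6).isLt
  fin_cases i <;> simp <;> omega

theorem comp_code (σ τ : Perm (Fin 7)) : comp (code σ) (code τ) = code (σ * τ) := by
  have h : ∀ i : Fin 7, digit (code σ) (digit (code τ) i) = (σ * τ) i := by
    intro i
    rw [digit_code, digit_code]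
    rfl
  rw [code_eq (σ * τ)]
  have h0 : digit (code σ) (digit (code τ) 0) = (σ * τ) 0 := h 0
  have h1 : digit (code σ) (digit (code τ) 1) = (σ * τ) 1 := h 1
  have h2 : digit (code σ) (digit (code τ) 2) = (σ * τ) 2 := h 2
  have h3 : digit (code σ) (digit (code τ) 3) = (σ * τ) 3 := h 3
  have h4 : digit (code σ) (digit (code τ) 4) = (σ * τ) 4 := h 4
  have h5 : digit (code σ) (digit (code τ) 5) = (σ * τ) 5 := h 5
  have h6 : digit (code σ) (digit (code τ) 6) = (σ * τ) 6 := h 6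
  rw [← h0, ← h1, ← h2, ← h3, ← h4, ← h5, ← h6]
  rfl

theorem code_injective : Function.Injective code := by
  intro σ τ h
  ext i
  rw [← digit_code, ← digit_code, h]

theorem ne_eq (a b : ℕ) : ne a b = if a = b then 0 else 1 := by
  change 1 - (1 - (a ^^^ b)) = _
  split_ifs with h
  · simp [h]
  · have : a ^^^ b ≠ 0 := fun h0 => h (Nat.xor_eq_zero_iff.1 h0)
    omega

theorem moved_code (σ : Perm (Fin 7)) : moved (code σ) = σ.support.card := by
  have h : ∀ i : Fin 7, ne (digit (code σ) i) i = if σ i ≠ i then 1 else 0 := by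
    intro i
    rw [digit_code, ne_eq]
    by_cases hi : σ i = i <;> simp [hi, Fin.val_inj]
  have h2 : σ.support.card = ∑ i : Fin 7, if σ i ≠ i then 1 else 0 := by
    rw [← Finset.card_filter]
    rfl
  have h0' : ne (digit (code σ) 0) 0 = if σ 0 ≠ 0 then 1 else 0 := h 0
  have h1' : ne (digit (code σ) 1) 1 = if σ 1 ≠ 1 then 1 else 0 := h 1
  have h2' : ne (digit (code σ) 2) 2 = if σ 2 ≠ 2 then 1 else 0 := h 2
  have h3' : ne (digit (code σ) 3) 3 = if σ 3 ≠ 3 then 1 else 0 := h 3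
  have h4' : ne (digit (code σ) 4) 4 = if σ 4 ≠ 4 then 1 else 0 := h 4
  have h5' : ne (digit (code σ) 5) 5 = if σ 5 ≠ 5 then 1 else 0 := h 5
  have h6' : ne (digit (code σ) 6) 6 = if σ 6 ≠ 6 then 1 else 0 := h 6
  have e : moved (code σ) = ne (digit (code σ) 0) 0 + (ne (digit (code σ) 1) 1 +
      (ne (digit (code σ) 2) 2 + (ne (digit (code σ) 3) 3 + (ne (digit (code σ) 4) 4 +
      (ne (digit (code σ) 5) 5 + ne (digit (code σ) 6) 6))))) := rfl
  rw [h2, e, Fin.sum_univ_seven, h0', h1', h2', h3', h4', h5', h6']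
  ring

theorem isMem_iff (p : ℕ) (T : List ℕ) : isMem p T = true ↔ p ∈ T := by
  rw [isMem, List.any_eq_true]
  constructor
  · rintro ⟨x, hx, h⟩
    rwa [Nat.eq_of_beq_eq_true h]
  · exact fun h => ⟨p, h, Nat.beq_refl p⟩

theorem nodup_of_distinct {l : List ℕ} (h : distinct l = true) : l.Nodup := by
  induction l with
  | nil => exact List.nodup_nil
  | cons a l ih =>
    simp only [distinct, Bool.and_eq_true, Bool.not_eq_true', ← Bool.not_eq_true, isMem_iff] at h
    exact List.nodup_cons.2 ⟨h.1, ih h.2⟩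

theorem apart_code (σ τ : Perm (Fin 7)) :
    apart (code σ) (code τ) = true ↔ σ⁻¹ * τ ∈ derangements (Fin 7) := by
  have h : ∀ i : Fin 7, Nat.beq (digit (code σ) i) (digit (code τ) i) = decide (σ i = τ i) := by
    intro i
    rw [digit_code, digit_code, Bool.eq_iff_iff]
    simp [Fin.val_inj]
  have h0 := h 0
  have h1 := h 1
  have h2 := h 2
  have h3 := h 3
  have h4 := h 4
  have h5 := h 5
  have h6 := h 6
  have key : σ⁻¹ * τ ∈ derangements (Fin 7) ↔ ∀ i, σ i ≠ τ i := by
    refine forall_congr' fun i => not_congr ?_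
    rw [Perm.mul_apply, Perm.inv_eq_iff_eq, eq_comm]
  rw [key]
  simp only [apart]
  simp only [Fin.val_zero, Fin.val_one, Fin.val_two] at h0 h1 h2
  change Nat.beq (digit (code σ) 3) (digit (code τ) 3) = _ at h3
  change Nat.beq (digit (code σ) 4) (digit (code τ) 4) = _ at h4
  change Nat.beq (digit (code σ) 5) (digit (code τ) 5) = _ at h5
  change Nat.beq (digit (code σ) 6) (digit (code τ) 6) = _ at h6
  rw [h0, h1, h2, h3, h4, h5, h6]
  simp [Fin.forall_fin_succ]

theorem mem_stab {σ : Perm (Fin 7)} (h : σ 0 = 0) : code σ ∈ stab := by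
  have h1 : (List.ofFn fun i => (σ i : ℕ)).Perm (List.ofFn fun i : Fin 7 => (i : ℕ)) :=
    σ.ofFn_comp_perm (fun i : Fin 7 => (i : ℕ))
  have h2 : (List.ofFn fun i : Fin 7 => (i : ℕ)) = 0 :: [1, 2, 3, 4, 5, 6] := rfl
  have h3 : (List.ofFn fun i => (σ i : ℕ)) = 0 :: List.ofFn fun i : Fin 6 => (σ i.succ : ℕ) := by
    rw [List.ofFn_succ, h]
    rfl
  rw [h2, h3] at h1
  rw [stab, List.mem_map]
  refine ⟨_, List.mem_permutations'.2 h1.cons_inv, ?_⟩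
  rw [code, h3]

end Seven
end DerangementProportion

namespace DerangementProportion
open Equiv MulAction

/-! ### Degree seven: groups containing the 7-cycle -/

theorem cosetCount_mul_right {n : ℕ} {G : Subgroup (Perm (Fin n))} (g : Perm (Fin n))
    {h : Perm (Fin n)} (hh : h ∈ G) : cosetCount G (g * h) = cosetCount G g := by
  rw [← cosetCount_eq_left, ← cosetCount_eq_left, mul_smul, smul_coe_set hh]

theorem exists_conj_eq_of_cycleType_eq {α : Type*} [Fintype α] [DecidableEq α] {σ τ : Perm α}
    (h : σ.cycleType = τ.cycleType) : ∃ x : Perm α, x * σ * x⁻¹ = τ :=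
  isConj_iff.1 (Perm.isConj_iff_cycleType_eq.2 h)

theorem mem_map_conj {H : Type*} [Group H] {G : Subgroup H} {x y : H} :
    y ∈ G.map (MulAut.conj x).toMonoidHom ↔ x⁻¹ * y * x ∈ G := by
  constructor
  · rintro ⟨z, hz, rfl⟩
    simpa [mul_assoc] using hz
  · intro h
    exact ⟨_, h, by simp [mul_assoc]⟩

theorem conj_mem_map_conj {H : Type*} [Group H] {G : Subgroup H} (x : H) {y : H} (hy : y ∈ G) :
    x * y * x⁻¹ ∈ G.map (MulAut.conj x).toMonoidHom :=
  ⟨y, hy, rfl⟩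

theorem le_of_le_map_conj {H : Type*} [Group H] {N G : Subgroup H} [hN : N.Normal] (x : H)
    (h : N ≤ G.map (MulAut.conj x).toMonoidHom) : N ≤ G := by
  intro y hy
  have := mem_map_conj.1 (h (hN.conj_mem y hy x))
  simpa [mul_assoc] using this

namespace Seven

/-- `p` is the code of an element of `G`. -/
def Coded (G : Subgroup (Perm (Fin 7))) (p : ℕ) : Prop := ∃ σ ∈ G, code σ = p

variable {G : Subgroup (Perm (Fin 7))}

theorem Coded.comp {p q : ℕ} (hp : Coded G p) (hq : Coded G q) : Coded G (Seven.comp p q) := by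
  obtain ⟨σ, hσ, rfl⟩ := hp
  obtain ⟨τ, hτ, rfl⟩ := hq
  exact ⟨σ * τ, G.mul_mem hσ hτ, (comp_code σ τ).symm⟩

theorem coded_code {σ : Perm (Fin 7)} : Coded G (code σ) ↔ σ ∈ G :=
  ⟨fun ⟨_, hτ, h⟩ => code_injective h ▸ hτ, fun h => ⟨σ, h, rfl⟩⟩

theorem code_pow_mem_rots (k : ℕ) : code (finRotate 7 ^ k) ∈ rots := by
  have h1 : finRotate 7 ^ k = finRotate 7 ^ (k % 7) := by
    have : orderOf (finRotate 7) = 7 := by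
      rw [(isCycle_finRotate (n := 5)).orderOf, support_finRotate]
      rfl
    conv_lhs => rw [← pow_mod_orderOf, this]
  have h2 : ∀ i : Fin 7, rots.getD i 0 ∈ rots := by decide
  rw [h1, ← rots_eq ⟨k % 7, Nat.mod_lt _ (by norm_num)⟩]
  exact h2 _

theorem coded_of_mem_rots (hc : finRotate 7 ∈ G) {r : ℕ} (hr : r ∈ rots) : Coded G r := by
  have h : ∀ r ∈ rots, ∃ i : Fin 7, rots.getD i 0 = r := by decide
  obtain ⟨i, rfl⟩ := h r hr
  rw [rots_eq]
  exact coded_code.2 (G.pow_mem hc _)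

theorem exists_norm_code (σ : Perm (Fin 7)) :
    ∃ k : ℕ, norm (code σ) = code (finRotate 7 ^ k * σ) ∧ (finRotate 7 ^ k * σ) 0 = 0 := by
  have h : ∀ x : Fin 7, (finRotate 7 ^ ((7 - (x : ℕ)) % 7)) x = 0 := by decide
  refine ⟨(7 - (σ 0 : ℕ)) % 7, ?_, h (σ 0)⟩
  have h0 : digit (code σ) 0 = σ 0 := digit_code σ 0
  have := rots_eq ⟨(7 - (σ 0 : ℕ)) % 7, Nat.mod_lt _ (by norm_num)⟩
  rw [← comp_code, ← this, norm, h0]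
  rfl

theorem Coded.norm (hc : finRotate 7 ∈ G) {p : ℕ} (hp : Coded G p) :
    Coded G (Seven.norm p) := by
  obtain ⟨σ, hσ, rfl⟩ := hp
  obtain ⟨k, hk, -⟩ := exists_norm_code σ
  rw [hk]
  exact coded_code.2 (G.mul_mem (G.pow_mem hc k) hσ)

theorem mem_full {T : List ℕ} {p : ℕ} : p ∈ full T ↔ ∃ t ∈ T, ∃ r ∈ rots, comp r t = p := by
  simp only [full, List.mem_flatMap, List.mem_map]

theorem code_mem_full (hc : finRotate 7 ∈ G) {T : List ℕ}
    (hT : ∀ σ ∈ G, σ 0 = 0 → code σ ∈ T) {σ : Perm (Fin 7)} (hσ : σ ∈ G) : code σ ∈ full T := by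
  obtain ⟨k, -, hk⟩ := exists_norm_code σ
  refine mem_full.2 ⟨_, hT _ (G.mul_mem (G.pow_mem hc k) hσ) hk, _, code_pow_mem_rots (6 * k), ?_⟩
  have h7 : finRotate 7 ^ 7 = 1 := by decide
  rw [comp_code, ← mul_assoc, ← pow_add, show 6 * k + k = 7 * k by ring, pow_mul, h7, one_pow,
    one_mul]

/-- `G` contains neither transpositions nor `3`-cycles. -/
def NoFew (G : Subgroup (Perm (Fin 7))) : Prop := ∀ p, Coded G p → few p = false

theorem NoFew.fewCoset (hG : NoFew G) (hc : finRotate 7 ∈ G) {p : ℕ} (hp : Coded G p) :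
    fewCoset p = false := by
  have h : ∀ p, Coded G p → fewPow p = false := by
    intro p hp
    have h2 := hp.comp hp
    have h3 := h2.comp hp
    simp only [fewPow, hG _ hp, hG _ h2, hG _ h3, hG _ (h2.comp h2), hG _ (h3.comp h2),
      Bool.or_self]
  rw [Seven.fewCoset, List.any_eq_false]
  intro r hr
  rw [h _ ((coded_of_mem_rots hc hr).comp hp)]
  simp

theorem coded_adjoin {p : ℕ} {T : List ℕ} (hp : Coded G p) (hT : ∀ t ∈ T, Coded G t) :
    ∀ t ∈ adjoin p T, Coded G t := by
  intro t ht
  rw [adjoin] at ht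
  cases h : isMem p T
  · rw [h, cond_false, List.mem_cons] at ht
    rcases ht with rfl | ht
    · exact hp
    · exact hT t ht
  · rw [h, cond_true] at ht
    exact hT t ht

theorem coded_grow (hc : finRotate 7 ∈ G) {l : ℕ} (hl : Coded G l) {S : List ℕ}
    (hS : ∀ t ∈ S, Coded G t) : ∀ t ∈ grow l S, Coded G t := by
  have inner : ∀ (R : List ℕ), (∀ r ∈ R, r ∈ rots) → ∀ a, Coded G a → ∀ acc : List ℕ,
      (∀ t ∈ acc, Coded G t) →
      ∀ t ∈ R.foldr (fun r acc => adjoin (norm (comp (comp a r) l)) acc) acc, Coded G t := by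
    intro R hR a ha acc hacc
    induction R with
    | nil => exact hacc
    | cons r R ih =>
      rw [List.foldr_cons]
      refine coded_adjoin (Coded.norm hc ((ha.comp (coded_of_mem_rots hc
        (hR r List.mem_cons_self))).comp hl)) ?_
      exact ih fun r hr => hR r (List.mem_cons_of_mem _ hr)
  have outer : ∀ S' : List ℕ, (∀ t ∈ S', Coded G t) → ∀ t ∈ S'.foldr (fun a acc =>
      rots.foldr (fun r acc => adjoin (norm (comp (comp a r) l)) acc) acc) S, Coded G t := by
    intro S' hS'
    induction S' with
    | nil => exact hS
    | cons a S' ih =>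
      rw [List.foldr_cons]
      exact inner rots (fun _ h => h) a (hS' a List.mem_cons_self) _
        (ih fun t ht => hS' t (List.mem_cons_of_mem _ ht))
  exact outer S hS

/-- A single element of the Fano stabiliser outside the multiplications, with the rotations,
generates the whole group: reach one of `gens`, then take three rounds of products. -/
theorem coded_of_mem_fano (hc : finRotate 7 ∈ G) {p : ℕ} (hp : p ∈ fano) (hpm : p ∉ mults)
    (hpG : Coded G p) {u : ℕ} (hu : u ∈ fano) : Coded G u := by
  obtain ⟨e, he, heG⟩ : ∃ e ∈ gens, Coded G e := by
    have h := List.all_eq_true.1 fano_reaches_gens p hp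
    simp only [Bool.or_eq_true, isMem_iff, List.any_eq_true] at h
    rcases h with (h | h) | ⟨r, hr, h⟩
    · exact absurd h hpm
    · exact ⟨p, h, hpG⟩
    · exact ⟨_, h, Coded.norm hc ((hpG.comp (coded_of_mem_rots hc hr)).comp hpG)⟩
  have h := List.all_eq_true.1 (List.all_eq_true.1 gens_generate e he) u hu
  rw [isMem_iff] at h
  have h0 : ∀ t ∈ [e], Coded G t := by simpa using heG
  exact coded_grow hc heG (coded_grow hc heG (coded_grow hc heG h0)) u h

theorem code_mem_fano (hG : NoFew G) (hc : finRotate 7 ∈ G) (hfano : ∀ u ∈ fano, Coded G u)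
    {σ : Perm (Fin 7)} (hσ : σ ∈ G) (h0 : σ 0 = 0) : code σ ∈ fano := by
  have hs := mem_stab h0
  have hσ' : Coded G (code σ) := coded_code.2 hσ
  have h1 := List.all_eq_true.1 stab_cases _ hs
  have h2 := List.all_eq_true.1 fano_maximal _ hs
  have h3 : (fano.any fun t => fewCoset (comp t (code σ))) = false := by
    rw [List.any_eq_false]
    intro t ht
    rw [hG.fewCoset hc ((hfano t ht).comp hσ')]
    simp
  have h4 : (rots.any fun r => fewCoset (comp (comp (code σ) r) (code σ))) = false := by
    rw [List.any_eq_false]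
    intro r hr
    rw [hG.fewCoset hc ((hσ'.comp (coded_of_mem_rots hc hr)).comp hσ')]
    simp
  rw [h4, hG.fewCoset hc hσ'] at h1
  rw [h3] at h2
  simp only [Bool.or_eq_true, isMem_iff, Bool.not_eq_true', Bool.or_false,
    ← Bool.not_eq_true] at h1 h2
  rcases h2 with h2 | h2
  · rcases h1 with (h1 | h1) | h1
    · exact absurd (Or.inl h1) h2
    · exact h1
    · exact absurd (Or.inr h1) h2
  · exact h2

theorem card_of_code_mem_iff {T : List ℕ} (hT : T.Nodup)
    (h : ∀ p, Coded G p ↔ p ∈ T) (q : ℕ → Bool) (P : Perm (Fin 7) → Prop)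
    (hq : ∀ σ, q (code σ) = true ↔ P σ) :
    {σ | σ ∈ G ∧ P σ}.ncard = (T.filter q).length := by
  rw [← Set.ncard_image_of_injective _ code_injective,
    ← List.toFinset_card_of_nodup (hT.filter q), ← Set.ncard_coe_finset]
  congr 1
  ext p
  simp only [Set.mem_image, Set.mem_ofPred_eq, Finset.mem_coe, List.mem_toFinset,
    List.mem_filter, ← h]
  constructor
  · rintro ⟨σ, ⟨hσ, hP⟩, rfl⟩
    exact ⟨coded_code.2 hσ, (hq σ).2 hP⟩
  · rintro ⟨⟨σ, hσ, rfl⟩, hp⟩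
    exact ⟨σ, ⟨hσ, (hq σ).1 hp⟩, rfl⟩

theorem exists_fixing_zero_one (hc : finRotate 7 ∈ G) (hfano : ∀ u ∈ fano, Coded G u)
    (g : Perm (Fin 7)) : ∃ h ∈ G, (h * g) 0 = 0 ∧ (h * g) 1 = 1 := by
  obtain ⟨k, -, hk⟩ := exists_norm_code g
  set x := finRotate 7 ^ k * g with hx
  have hx1 : x 1 ≠ 0 := by
    rw [← hk]
    exact x.injective.ne (by decide)
  have hmem : ((x 1 : Fin 7) : ℕ) ∈ ([1, 2, 3, 4, 5, 6] : List ℕ) := by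
    revert hx1
    generalize x 1 = y
    revert y
    decide
  have h1 := List.all_eq_true.1 fano_transitive _ hmem
  obtain ⟨t, ht, htx⟩ := List.any_eq_true.1 h1
  have ht0 : ∀ t ∈ fano, digit t 0 = 0 := by decide +kernel
  have ht0 := ht0 t ht
  obtain ⟨τ, hτ, rfl⟩ := hfano t ht
  have htx := Nat.eq_of_beq_eq_true htx
  rw [digit_code] at htx
  have h2 : digit (code τ) 0 = τ 0 := digit_code τ 0
  rw [h2] at ht0
  refine ⟨τ * finRotate 7 ^ k, G.mul_mem hτ (G.pow_mem hc k), ?_, ?_⟩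
  · rw [mul_assoc, ← hx, Perm.mul_apply, hk]
    exact Fin.ext ht0
  · rw [mul_assoc, ← hx, Perm.mul_apply]
    exact Fin.ext htx

theorem E_seven : E 7 = 1860 := by
  norm_num [E, numDerangements]

/-- A group with the required coset whose point stabiliser contains an element of the stabiliser in
the group of the Fano plane is excluded. -/
theorem false_of_mem_fano (hG : NoFew G) (hc : finRotate 7 ∈ G) {g : Perm (Fin 7)}
    (hg : (cosetCount G g : ℤ) * G.index = E 7) {p : ℕ} (hp : p ∈ fano) (hpm : p ∉ mults)
    (hpG : Coded G p) : False := by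
  have hfano : ∀ u ∈ fano, Coded G u := fun u hu => coded_of_mem_fano hc hp hpm hpG hu
  have hiff : ∀ p, Coded G p ↔ p ∈ full fano := by
    intro p
    constructor
    · rintro ⟨σ, hσ, rfl⟩
      exact code_mem_full hc (fun σ hσ h0 => code_mem_fano hG hc hfano hσ h0) hσ
    · intro h
      obtain ⟨t, ht, r, hr, rfl⟩ := mem_full.1 h
      exact (coded_of_mem_rots hc hr).comp (hfano t ht)
  have hd := full_fano_distinct
  rw [Bool.and_eq_true] at hd
  have hnd := nodup_of_distinct hd.1
  have hcard : Nat.card G = 168 := by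
    have := card_of_code_mem_iff hnd hiff (fun _ => true) (fun _ => True) (by simp)
    simp only [and_true, List.filter_true] at this
    rw [Nat.eq_of_beq_eq_true hd.2] at this
    exact this
  have hindex : G.index = 30 := by
    have := G.card_mul_index
    rw [hcard, Nat.card_eq_fintype_card, Fintype.card_perm, Fintype.card_fin] at this
    have h7 : 7 ! = 5040 := rfl
    omega
  have hcount : cosetCount G g = 62 := by
    rw [hindex, E_seven] at hg
    omega
  -- The representative of the coset is changed to the inverse of some `q` fixing 0 and 1; then `q⁻¹
  -- * x` is a derangement exactly when `q` and `x` agree nowhere.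
  obtain ⟨h, hh, h0, h1⟩ := exists_fixing_zero_one hc hfano g⁻¹
  rw [← cosetCount_mul_right g (G.inv_mem hh)] at hcount
  set q := h * g⁻¹ with hq
  have hq' : g * h⁻¹ = q⁻¹ := by rw [hq]; group
  rw [hq', cosetCount, card_of_code_mem_iff hnd hiff (apart (code q))
    (fun x => q⁻¹ * x ∈ derangements (Fin 7)) (fun σ => apart_code q σ)] at hcount
  have hfin := List.all_eq_true.1 fano_coset_counts _ (mem_stab h0)
  have hd1 : digit (code q) 1 = q 1 := digit_code q 1
  rw [hcount, hd1, h1] at hfin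
  exact absurd hfin (by decide)

theorem noFew_of_not_le (hprim : IsPreprimitive G (Fin 7))
    (hA : ¬ alternatingGroup (Fin 7) ≤ G) : NoFew G := by
  rintro _ ⟨σ, hσ, rfl⟩
  rw [← Bool.not_eq_true]
  intro h
  apply hA
  rw [few, Bool.and_eq_true, moved_code] at h
  have h3 := Nat.le_of_ble_eq_true h.1
  have h2 := Nat.le_of_ble_eq_true h.2
  have h23 : σ.support.card = 2 ∨ σ.support.card = 3 := by omega
  rcases h23 with h | h
  · rw [Perm.subgroup_eq_top_of_isPreprimitive_of_isSwap_mem hprim σ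
      (Perm.card_support_eq_two.1 h) hσ]
    exact le_top
  · exact Perm.alternatingGroup_le_of_isPreprimitive_of_isThreeCycle_mem hprim
      (card_support_eq_three_iff.1 h) hσ

theorem alternatingGroup_le_of_finRotate_mem (hc : finRotate 7 ∈ G) {g : Perm (Fin 7)}
    (hg : (cosetCount G g : ℤ) * G.index = E 7) : alternatingGroup (Fin 7) ≤ G := by
  by_contra hA
  have hd : (G.index : ℤ) ∣ E 7 := Dvd.intro_left _ hg
  have hG := noFew_of_not_le (isPreprimitive_of_index_dvd le_rfl hd) hA
  -- If the stabiliser of 0 had only multiplications, the order would be at most 7 * 6 = 42; but the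
  -- index divides gcd(1860, 5040) = 60, and 42 * 60 < 5040.
  obtain ⟨σ, hσ, h0, hm⟩ : ∃ σ ∈ G, σ 0 = 0 ∧ code σ ∉ mults := by
    by_contra hcon
    push Not at hcon
    have h1 : (G : Set (Perm (Fin 7))).ncard ≤ 42 := by
      rw [← Set.ncard_image_of_injective _ code_injective]
      calc (code '' (G : Set (Perm (Fin 7)))).ncard
          ≤ ((full mults).toFinset : Set ℕ).ncard := by
            apply Set.ncard_le_ncard _ (Finset.finite_toSet _)
            rintro _ ⟨σ, hσ, rfl⟩
            simpa using code_mem_full hc hcon hσ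
        _ ≤ (full mults).length := by
            rw [Set.ncard_coe_finset]
            exact List.toFinset_card_le _
        _ = 42 := rfl
    have h2 := G.card_mul_index
    rw [Nat.card_eq_fintype_card (α := Perm (Fin 7)), Fintype.card_perm, Fintype.card_fin,
      show 7 ! = 5040 from rfl] at h2
    have h3 : G.index ∣ 60 := by
      have h4 : G.index ∣ 1860 := by
        rw [E_seven] at hd
        exact_mod_cast hd
      exact (Nat.dvd_gcd h4 (Dvd.intro_left _ h2)).trans (by norm_num)
    have h4 := Nat.le_of_dvd (by norm_num) h3
    change Nat.card G ≤ 42 at h1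
    have := Nat.mul_le_mul h1 h4
    omega
  have hσ' : Coded G (code σ) := coded_code.2 hσ
  have h1 := List.all_eq_true.1 stab_cases _ (mem_stab h0)
  have h4 : (rots.any fun r => fewCoset (comp (comp (code σ) r) (code σ))) = false := by
    rw [List.any_eq_false]
    intro r hr
    rw [hG.fewCoset hc ((hσ'.comp (coded_of_mem_rots hc hr)).comp hσ')]
    simp
  rw [h4, hG.fewCoset hc hσ'] at h1
  simp only [Bool.or_eq_true, isMem_iff, Bool.or_false] at h1
  rcases h1 with (h1 | h1) | h1
  · exact hm h1
  · exact false_of_mem_fano hG hc hg h1 hm hσ'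
  -- Negation inverts the rotation and exchanges the two Fano planes, so conjugating by it reduces
  -- to the previous case.
  · obtain ⟨ν, hν, hν2, hνc⟩ := neg_eq
    have hνinv : ν⁻¹ = ν := inv_eq_of_mul_eq_one_right hν2
    rw [← hν, comp_code, comp_code] at h1
    have hg' : (cosetCount (G.map (MulAut.conj ν).toMonoidHom) (ν * g * ν⁻¹) : ℤ) *
        (G.map (MulAut.conj ν).toMonoidHom).index = E 7 := by
      rw [cosetCount_conj, index_map_conj, hg]
    have hA' : ¬ alternatingGroup (Fin 7) ≤ G.map (MulAut.conj ν).toMonoidHom :=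
      fun h => hA (le_of_le_map_conj ν h)
    refine false_of_mem_fano (noFew_of_not_le (isPreprimitive_of_index_dvd le_rfl
      (Dvd.intro_left _ hg')) hA') ?_ hg' h1 ?_ (coded_code.2 ?_)
    · have := conj_mem_map_conj ν hc
      rw [hνc] at this
      exact inv_mem_iff.1 this
    · intro hm'
      apply hm
      have hcl : ∀ m ∈ mults, comp neg (comp m neg) ∈ mults := by decide +kernel
      have := hcl _ hm'
      rw [← hν, comp_code, comp_code] at this
      rwa [show ν * (ν * (σ * ν) * ν) = (ν * ν) * σ * (ν * ν) by group, hν2, one_mul,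
        mul_one] at this
    · have := conj_mem_map_conj ν hσ
      rwa [hνinv, mul_assoc] at this

end Seven

theorem eq_alternatingGroup_of_eq_seven {G : Subgroup (Perm (Fin 7))}
    {g : Perm (Fin 7)} (hg : (cosetCount G g : ℤ) * G.index = E 7) :
    G = alternatingGroup (Fin 7) := by
  have hd : (G.index : ℤ) ∣ E 7 := Dvd.intro_left _ hg
  have := Fact.mk (show Nat.Prime 7 by norm_num)
  have h7 : ¬ 7 ∣ G.index := not_dvd_index_of_not_dvd_E hd (by rw [Seven.E_seven]; norm_num)
  obtain ⟨c, hcG, hc, hcp⟩ := exists_isCycle_mem h7 (by simp)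
  obtain ⟨x, hx⟩ := exists_conj_eq_of_cycleType_eq (σ := c) (τ := finRotate 7) (by
    rw [hc.cycleType, hcp, cycleType_finRotate])
  refine eq_alternatingGroup_of_le (by norm_num) hg (le_of_le_map_conj x ?_)
  refine Seven.alternatingGroup_le_of_finRotate_mem (g := x * g * x⁻¹) ?_ ?_
  · rw [← hx]
    exact conj_mem_map_conj x hcG
  · rw [cosetCount_conj, index_map_conj, hg]

theorem eq_alternatingGroup_of_seven_le {n : ℕ} (hn : 7 ≤ n) {G : Subgroup (Perm (Fin n))}
    {g : Perm (Fin n)} (h : (cosetCount G g : ℤ) * G.index = E n) :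
    G = alternatingGroup (Fin n) := by
  rcases hn.eq_or_lt with rfl | h8
  · exact eq_alternatingGroup_of_eq_seven h
  · exact eq_alternatingGroup_of_eight_le h8 h

end DerangementProportion

namespace DerangementProportion
open Equiv MulAction

/-! ### Tools for the small degrees -/

theorem mem_iff_of_subset_finset {H : Type*} [Group H] [Finite H] {G : Subgroup H} {F : Finset H}
    (h : ∀ σ ∈ G, σ ∈ F) (hc : F.card ≤ Nat.card G) (σ : H) : σ ∈ G ↔ σ ∈ F := by
  have : (G : Set H) = F := Set.eq_of_subset_of_ncard_le h (by
    rw [Set.ncard_coe_finset]; exact hc) (Finset.finite_toSet F)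
  rw [← SetLike.mem_coe, this, Finset.mem_coe]

theorem mem_iff_of_finset_subset {H : Type*} [Group H] [Finite H] {G : Subgroup H} {F : Finset H}
    (h : ∀ σ ∈ F, σ ∈ G) (hc : Nat.card G ≤ F.card) (σ : H) : σ ∈ G ↔ σ ∈ F := by
  have : (F : Set H) = G := Set.eq_of_subset_of_ncard_le h (by
    rw [Set.ncard_coe_finset]; exact hc) (Set.toFinite _)
  rw [← SetLike.mem_coe, ← this, Finset.mem_coe]

theorem le_card_of_finset_subset {H : Type*} [Group H] [Finite H] {G : Subgroup H} {F : Finset H}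
    (h : ∀ σ ∈ F, σ ∈ G) : F.card ≤ Nat.card G := by
  rw [← Set.ncard_coe_finset]
  exact Set.ncard_le_ncard (t := (G : Set H)) h (Set.toFinite _)

theorem cosetCount_eq_card_filter {n : ℕ} {G : Subgroup (Perm (Fin n))}
    {F : Finset (Perm (Fin n))} (hF : ∀ σ, σ ∈ G ↔ σ ∈ F) (g : Perm (Fin n)) :
    cosetCount G g = (F.filter fun h => ∀ i, g (h i) ≠ i).card := by
  rw [cosetCount, ← Set.ncard_coe_finset]
  congr 1
  ext h
  simp [hF, derangements]

theorem card_mul_index_eq {n : ℕ} (G : Subgroup (Perm (Fin n))) :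
    Nat.card G * G.index = n ! := by
  rw [G.card_mul_index, Nat.card_eq_fintype_card, Fintype.card_perm, Fintype.card_fin]

/-- The existence of a suitable coset can be checked after conjugation. -/
theorem exists_cosetCount_of_conj {n : ℕ} {G : Subgroup (Perm (Fin n))} (x : Perm (Fin n))
    (h : ∃ g, (cosetCount (G.map (MulAut.conj x).toMonoidHom) g : ℤ) *
      (G.map (MulAut.conj x).toMonoidHom).index = E n) :
    ∃ g, (cosetCount G g : ℤ) * G.index = E n := by
  obtain ⟨g, hg⟩ := h
  refine ⟨x⁻¹ * g * x, ?_⟩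
  rw [index_map_conj] at hg
  rw [← cosetCount_conj G x, ← hg]
  congr 3
  group

theorem map_conj_map_conj_inv {H : Type*} [Group H] (G : Subgroup H) (x : H) :
    (G.map (MulAut.conj x).toMonoidHom).map (MulAut.conj x⁻¹).toMonoidHom = G := by
  ext y
  rw [mem_map_conj, mem_map_conj]
  simp [mul_assoc]

theorem isConjSubgroup_of_map_conj_eq {n : ℕ} {G H : Subgroup (Perm (Fin n))} (x : Perm (Fin n))
    (h : G.map (MulAut.conj x).toMonoidHom = H) : IsConjSubgroup G H :=
  ⟨x⁻¹, by rw [← h, map_conj_map_conj_inv]⟩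

theorem card_map_conj {H : Type*} [Group H] (G : Subgroup H) (x : H) :
    Nat.card (G.map (MulAut.conj x).toMonoidHom) = Nat.card G :=
  Nat.card_congr (G.equivMapOfInjective _ (MulAut.conj x).injective).toEquiv.symm

/-- A conjugate of `closure S` of order `F.card`, where `F` is a set of words in `S`, has a suitable
coset as soon as `F` does. -/
theorem exists_cosetCount_of_isConjSubgroup {n : ℕ} {G : Subgroup (Perm (Fin n))}
    {S : Set (Perm (Fin n))} (h : IsConjSubgroup G (Subgroup.closure S))
    {F : Finset (Perm (Fin n))} (hF : ∀ σ ∈ F, σ ∈ Subgroup.closure S)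
    (hcard : Nat.card G = F.card)
    (hg : ∃ g : Perm (Fin n), ((F.filter fun h => ∀ i, g (h i) ≠ i).card : ℤ) * (n ! / F.card) =
      E n) : ∃ g, (cosetCount G g : ℤ) * G.index = E n := by
  obtain ⟨x, rfl⟩ := h
  rw [card_map_conj] at hcard
  obtain ⟨g, hg⟩ := hg
  refine exists_cosetCount_conj x ⟨g, ?_⟩
  rw [cosetCount_eq_card_filter (mem_iff_of_finset_subset hF hcard.le), ← hg]
  congr 1
  have h1 := card_mul_index_eq (Subgroup.closure S)
  have h2 : 0 < Nat.card (Subgroup.closure S) := Nat.card_pos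
  rw [← h1, ← hcard]
  push_cast
  rw [Int.mul_ediv_cancel_left]
  exact_mod_cast h2.ne'

/-- If `G` contains `S` and has the same order as a set of words in `S`, then `G = closure S`. -/
theorem eq_closure_of_card_le {H : Type*} [Group H] [Finite H] {G : Subgroup H} {S : Set H}
    (hS : ∀ s ∈ S, s ∈ G) {F : Finset H} (hF : ∀ σ ∈ F, σ ∈ Subgroup.closure S)
    (hcard : Nat.card G ≤ F.card) : G = Subgroup.closure S := by
  have h1 : Subgroup.closure S ≤ G := (Subgroup.closure_le G).2 hS
  exact (Subgroup.eq_of_le_of_card_ge h1 (hcard.trans (le_card_of_finset_subset hF))).symm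

/-! ### Degree at most three -/

/-- The index divides 2 in both cases (2! = 2, and gcd(4, 6) = 2 for `n = 3`), while index 1 is
impossible and index 2 is the alternating group. -/
theorem not_exists_cosetCount_of_le_three {n : ℕ} (hn : 2 ≤ n) (hn3 : n ≤ 3)
    {G : Subgroup (Perm (Fin n))} (hG : G ≠ alternatingGroup (Fin n)) :
    ¬ ∃ g, (cosetCount G g : ℤ) * G.index = E n := by
  rintro ⟨g, hg⟩
  have : Nontrivial (Fin n) := Fin.nontrivial_iff_two_le.mpr hn
  have h1 : G.index ≠ 1 := fun h => index_ne_one hn hg (Subgroup.index_eq_one.1 h)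
  have h2 : G.index ≠ 2 := fun h => hG (Perm.eq_alternatingGroup_of_index_eq_two h)
  have h3 : G.index ∣ n ! := Dvd.intro_left _ (card_mul_index_eq G)
  have h4 : G.index ∣ 2 := by
    interval_cases n
    · exact h3
    · have h5 : (G.index : ℤ) ∣ E 3 := Dvd.intro_left _ hg
      have h6 : E 3 = 4 := by norm_num [E, numDerangements]
      rw [h6] at h5
      exact (Nat.dvd_gcd (by exact_mod_cast h5) h3 : G.index ∣ Nat.gcd 4 6)
  rcases (Nat.dvd_prime Nat.prime_two).1 h4 with h | h
  · exact h1 h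
  · exact h2 h

/-! ### Degree four -/

namespace Four

theorem E_four : E 4 = 6 := by norm_num [E, numDerangements]

/-- The four-cycle `(0 3 1 2)`. -/
abbrev w : Perm (Fin 4) := cyc [0, 3, 1, 2]
abbrev d : Perm (Fin 4) := cyc [0, 1] * cyc [2, 3]
abbrev t : Perm (Fin 4) := cyc [2, 3]

theorem cyclic_words : ∀ σ ∈ ({1, w, w * w, w * w * w} : Finset (Perm (Fin 4))),
    σ ∈ Subgroup.closure ({w, d} : Set (Perm (Fin 4))) := by
  have hw : w ∈ Subgroup.closure ({w, d} : Set (Perm (Fin 4))) :=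
    Subgroup.subset_closure (by simp)
  intro σ hσ
  simp only [Finset.mem_insert, Finset.mem_singleton] at hσ
  rcases hσ with rfl | rfl | rfl | rfl
  · exact one_mem _
  · exact hw
  · exact mul_mem hw hw
  · exact mul_mem (mul_mem hw hw) hw

theorem klein_words : ∀ σ ∈ ({1, t, d, t * d} : Finset (Perm (Fin 4))),
    σ ∈ Subgroup.closure ({t, d} : Set (Perm (Fin 4))) := by
  have ht : t ∈ Subgroup.closure ({t, d} : Set (Perm (Fin 4))) :=
    Subgroup.subset_closure (by simp)
  have hd : d ∈ Subgroup.closure ({t, d} : Set (Perm (Fin 4))) :=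
    Subgroup.subset_closure (by simp)
  intro σ hσ
  simp only [Finset.mem_insert, Finset.mem_singleton] at hσ
  rcases hσ with rfl | rfl | rfl | rfl
  · exact one_mem _
  · exact ht
  · exact hd
  · exact mul_mem ht hd

theorem conj_cases : ∀ σ : Perm (Fin 4), σ ^ 4 = 1 → (∃ x : Perm (Fin 4), x * σ * x⁻¹ = w) ∨
    (∃ x : Perm (Fin 4), x * σ * x⁻¹ = t) ∨
    σ ∈ ({1, d, cyc [0, 2] * cyc [1, 3], cyc [0, 3] * cyc [1, 2]} : Finset (Perm (Fin 4))) := by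
  decide +kernel

/-- Excludes the one group of order 4 not in the list: index 6 calls for exactly 6 / 6 = 1
derangement. -/
theorem normal_klein_count : ∀ g : Perm (Fin 4),
    (({1, d, cyc [0, 2] * cyc [1, 3], cyc [0, 3] * cyc [1, 2]} : Finset (Perm (Fin 4))).filter
      fun h => ∀ i, g (h i) ≠ i).card ≠ 1 := by
  decide +kernel

theorem isExceptional_of_exists {G : Subgroup (Perm (Fin 4))}
    (hG : G ≠ alternatingGroup (Fin 4)) {g : Perm (Fin 4)}
    (hg : (cosetCount G g : ℤ) * G.index = E 4) : IsExceptional 4 G := by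
  have h0 := card_mul_index_eq G
  rw [show 4 ! = 24 from rfl] at h0
  have h1 : G.index ≠ 1 := fun h => index_ne_one (by norm_num) hg (Subgroup.index_eq_one.1 h)
  have h2 : G.index ≠ 2 := fun h => hG (Perm.eq_alternatingGroup_of_index_eq_two h)
  rw [E_four] at hg
  have h3 : G.index ∣ 6 := by
    have : (G.index : ℤ) ∣ 6 := Dvd.intro_left _ hg
    exact_mod_cast this
  have h4 := Nat.le_of_dvd (by norm_num) h3
  have h5 : G.index = 3 ∨ G.index = 6 := by
    interval_cases G.index <;> omega
  rcases h5 with h5 | h5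
  · exact Or.inr (Or.inr (by rw [h5] at h0; omega))
  have hcard : Nat.card G = 4 := by rw [h5] at h0; omega
  have hcount : cosetCount G g = 1 := by rw [h5] at hg; omega
  have hpow : ∀ σ ∈ G, σ ^ 4 = 1 := by
    intro σ hσ
    have := pow_card_eq_one' (x := (⟨σ, hσ⟩ : G))
    rw [hcard] at this
    simpa using congrArg Subtype.val this
  by_cases hw : ∃ σ ∈ G, ∃ x : Perm (Fin 4), x * σ * x⁻¹ = w
  · obtain ⟨σ, hσ, x, hx⟩ := hw
    refine Or.inl ⟨hcard, isConjSubgroup_of_map_conj_eq x ?_⟩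
    have hwG := conj_mem_map_conj x hσ
    rw [hx] at hwG
    refine eq_closure_of_card_le ?_ cyclic_words ?_
    · rintro s (rfl | rfl)
      · exact hwG
      · rw [show cyc [0, 1] * cyc [2, 3] = w * w by decide]
        exact mul_mem hwG hwG
    · rw [card_map_conj, hcard]
      decide
  by_cases ht : ∃ σ ∈ G, ∃ x : Perm (Fin 4), x * σ * x⁻¹ = t
  · obtain ⟨σ, hσ, x, hx⟩ := ht
    refine Or.inr (Or.inl ⟨hcard, isConjSubgroup_of_map_conj_eq x ?_⟩)
    have htG := conj_mem_map_conj x hσ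
    rw [hx] at htG
    set G' := G.map (MulAut.conj x).toMonoidHom with hG'
    have hcard' : Nat.card G' = 4 := by rw [card_map_conj, hcard]
    -- A group of order 4 is abelian, so it lies in the centraliser of the transposition, which
    -- itself has only four elements.
    have hcomm : ∀ a ∈ G', a * t = t * a := by
      have : Fact (Nat.Prime 2) := ⟨Nat.prime_two⟩
      have hc : IsMulCommutative G' := IsPGroup.isMulCommutative_of_card_eq_prime_sq (p := 2)
        (by rw [hcard']; norm_num)
      intro a ha
      have := hc.is_comm.comm (⟨a, ha⟩ : G') ⟨t, htG⟩
      simpa using congrArg Subtype.val this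
    have hcent : ∀ a : Perm (Fin 4), a * t = t * a →
        a ∈ ({1, t, d, t * d} : Finset (Perm (Fin 4))) := by decide +kernel
    have hmem := mem_iff_of_subset_finset (G := G') (fun a ha => hcent a (hcomm a ha))
      (by rw [hcard']; decide)
    refine eq_closure_of_card_le ?_ klein_words ?_
    · rintro s (rfl | rfl)
      · exact htG
      · exact (hmem _).2 (by decide)
    · rw [hcard']
      decide
  · exfalso
    have hV : ∀ σ ∈ G, σ ∈ ({1, d, cyc [0, 2] * cyc [1, 3], cyc [0, 3] * cyc [1, 2]} :
        Finset (Perm (Fin 4))) := by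
      intro σ hσ
      rcases conj_cases σ (hpow σ hσ) with h | h | h
      · exact absurd ⟨σ, hσ, h⟩ hw
      · exact absurd ⟨σ, hσ, h⟩ ht
      · exact h
    have hmem := mem_iff_of_subset_finset hV (by rw [hcard]; decide)
    rw [cosetCount_eq_card_filter hmem] at hcount
    exact normal_klein_count g hcount

/-- The dihedral group of order `8` normalising the subgroup generated by `w`. -/
def dihedral : Subgroup (Perm (Fin 4)) where
  carrier := {σ | σ * w * σ⁻¹ = w ∨ σ * w * σ⁻¹ = w⁻¹}
  one_mem' := by simp
  mul_mem' := by
    have h : ∀ σ τ : Perm (Fin 4), (σ * w * σ⁻¹ = w ∨ σ * w * σ⁻¹ = w⁻¹) →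
        (τ * w * τ⁻¹ = w ∨ τ * w * τ⁻¹ = w⁻¹) →
        (σ * τ * w * (σ * τ)⁻¹ = w ∨ σ * τ * w * (σ * τ)⁻¹ = w⁻¹) := by decide +kernel
    exact fun {a b} ha hb => h a b ha hb
  inv_mem' := by
    have h : ∀ σ : Perm (Fin 4), (σ * w * σ⁻¹ = w ∨ σ * w * σ⁻¹ = w⁻¹) →
        (σ⁻¹ * w * σ⁻¹⁻¹ = w ∨ σ⁻¹ * w * σ⁻¹⁻¹ = w⁻¹) := by decide +kernel
    exact fun {a} ha => h a ha

theorem card_dihedral : Nat.card dihedral = 2 ^ 3 := by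
  have h : (dihedral : Set (Perm (Fin 4))) = (Finset.univ.filter (fun σ : Perm (Fin 4) =>
      σ * w * σ⁻¹ = w ∨ σ * w * σ⁻¹ = w⁻¹) : Finset (Perm (Fin 4))) := by
    ext σ
    simp [dihedral]
  change (dihedral : Set (Perm (Fin 4))).ncard = _
  rw [h, Set.ncard_coe_finset]
  decide +kernel

theorem exists_of_isExceptional {G : Subgroup (Perm (Fin 4))} (h : IsExceptional 4 G) :
    ∃ g, (cosetCount G g : ℤ) * G.index = E 4 := by
  rcases h with ⟨hcard, h⟩ | ⟨hcard, h⟩ | hcard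
  · refine exists_cosetCount_of_isConjSubgroup h cyclic_words (by rw [hcard]; decide) ?_
    rw [E_four]
    decide +kernel
  · refine exists_cosetCount_of_isConjSubgroup h klein_words (by rw [hcard]; decide) ?_
    rw [E_four]
    decide +kernel
  · have : Fact (Nat.Prime 2) := ⟨Nat.prime_two⟩
    have h0 := card_mul_index_eq G
    rw [show 4 ! = 24 from rfl, hcard] at h0
    have hindex : G.index = 3 := by omega
    have hQ : IsPGroup 2 dihedral := IsPGroup.of_card (n := 3) card_dihedral
    -- Subgroups of order 8 are Sylow, so one dihedral group stands for all.
    obtain ⟨x, hx⟩ := exists_conj_mem_of_isPGroup (G := G) hQ (by rw [hindex]; norm_num)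
    refine exists_cosetCount_of_conj x⁻¹ ?_
    have hF : ∀ σ ∈ Finset.univ.filter (fun σ : Perm (Fin 4) => σ * w * σ⁻¹ = w ∨ σ * w * σ⁻¹ = w⁻¹),
        σ ∈ G.map (MulAut.conj x⁻¹).toMonoidHom := by
      intro σ hσ
      rw [mem_map_conj, inv_inv]
      exact hx σ (Finset.mem_filter.1 hσ).2
    have hcard' : Nat.card (G.map (MulAut.conj x⁻¹).toMonoidHom) ≤ (Finset.univ.filter
        (fun σ : Perm (Fin 4) => σ * w * σ⁻¹ = w ∨ σ * w * σ⁻¹ = w⁻¹)).card := by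
      rw [card_map_conj, hcard]
      decide +kernel
    have hmem := mem_iff_of_finset_subset hF hcard'
    obtain ⟨g, hg⟩ : ∃ g : Perm (Fin 4), ((Finset.univ.filter (fun σ : Perm (Fin 4) =>
        σ * w * σ⁻¹ = w ∨ σ * w * σ⁻¹ = w⁻¹)).filter fun h => ∀ i, g (h i) ≠ i).card = 2 := by
      decide +kernel
    refine ⟨g, ?_⟩
    rw [index_map_conj, hindex, cosetCount_eq_card_filter hmem, hg, E_four]
    norm_num

theorem exists_iff_isExceptional {G : Subgroup (Perm (Fin 4))}
    (hG : G ≠ alternatingGroup (Fin 4)) :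
    (∃ g, (cosetCount G g : ℤ) * G.index = E 4) ↔ IsExceptional 4 G :=
  ⟨fun ⟨_, hg⟩ => isExceptional_of_exists hG hg, exists_of_isExceptional⟩

end Four

/-! ### Degree five -/

namespace Five

theorem E_five : E 5 = 48 := by norm_num [E, numDerangements]

/-- A finite set containing every subgroup of order `d < 25` that contains the `5`-cycle
`finRotate 5`. -/
abbrev frobenius (d : ℕ) : Finset (Perm (Fin 5)) :=
  Finset.univ.filter fun σ => (∃ k : Fin 5, σ * finRotate 5 * σ⁻¹ = finRotate 5 ^ (k : ℕ)) ∧ σ ^ d = 1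

/-- Two distinct subgroups of order 5 have 25 products, so a group of order below 25 normalises its
5-cycle. -/
theorem mem_powers_or_card : ∀ τ : Perm (Fin 5), τ ^ 5 = 1 →
    (∃ k : Fin 5, τ = finRotate 5 ^ (k : ℕ)) ∨
      ((Finset.univ : Finset (Fin 5 × Fin 5)).image fun p =>
        finRotate 5 ^ (p.1 : ℕ) * τ ^ (p.2 : ℕ)).card = 25 := by
  decide +kernel

theorem mem_frobenius {G : Subgroup (Perm (Fin 5))} (hc : finRotate 5 ∈ G)
    (hG : Nat.card G < 25) : ∀ σ ∈ G, σ ∈ frobenius (Nat.card G) := by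
  intro σ hσ
  refine Finset.mem_filter.2 ⟨Finset.mem_univ _, ?_, ?_⟩
  · have h5 : finRotate 5 ^ 5 = 1 := by decide
    refine (mem_powers_or_card (σ * finRotate 5 * σ⁻¹) (by
      rw [conj_pow, h5, mul_one, mul_inv_cancel])).resolve_right fun h => ?_
    have h1 := le_card_of_finset_subset (G := G) (F := (Finset.univ : Finset (Fin 5 × Fin 5)).image
      fun p => finRotate 5 ^ (p.1 : ℕ) * (σ * finRotate 5 * σ⁻¹) ^ (p.2 : ℕ)) (by
        intro τ hτ
        obtain ⟨p, -, rfl⟩ := Finset.mem_image.1 hτ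
        exact mul_mem (pow_mem hc _) (pow_mem (mul_mem (mul_mem hσ hc) (inv_mem hσ)) _))
    omega
  · exact congrArg Subtype.val (pow_card_eq_one' (x := (⟨σ, hσ⟩ : G)))

theorem exists_conj_finRotate_mem {G : Subgroup (Perm (Fin 5))} (h : ¬ 5 ∣ G.index) :
    ∃ x : Perm (Fin 5), finRotate 5 ∈ G.map (MulAut.conj x).toMonoidHom := by
  have := Fact.mk Nat.prime_five
  obtain ⟨c, hcG, hc, hcp⟩ := exists_isCycle_mem h (by simp)
  obtain ⟨x, hx⟩ := exists_conj_eq_of_cycleType_eq (σ := c) (τ := finRotate 5) (by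
    rw [hc.cycleType, hcp, cycleType_finRotate])
  exact ⟨x, hx ▸ conj_mem_map_conj x hcG⟩

theorem exists_of_isExceptional {G : Subgroup (Perm (Fin 5))} (h : IsExceptional 5 G) :
    ∃ g, (cosetCount G g : ℤ) * G.index = E 5 := by
  have h0 := card_mul_index_eq G
  rw [show 5 ! = 120 from rfl] at h0
  have h5 : ¬ 5 ∣ G.index := by
    rcases h with h | h | h <;> rw [h] at h0 <;> omega
  obtain ⟨x, hx⟩ := exists_conj_finRotate_mem h5
  refine exists_cosetCount_of_conj x ?_
  rw [← card_map_conj G x, ← index_map_conj G x] at h0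
  change Nat.card G = 5 ∨ Nat.card G = 10 ∨ Nat.card G = 20 at h
  rw [← card_map_conj G x] at h
  generalize G.map (MulAut.conj x).toMonoidHom = G' at h h0 hx
  have hm := mem_frobenius hx (by omega)
  have hmem := mem_iff_of_subset_finset hm (by
    rcases h with h | h | h <;> rw [h] <;> decide +kernel)
  rcases h with h | h | h <;> rw [h] at hmem h0
  · obtain ⟨g, hg⟩ : ∃ g : Perm (Fin 5),
        ((frobenius 5).filter fun h => ∀ i, g (h i) ≠ i).card = 2 := by decide +kernel
    refine ⟨g, ?_⟩
    rw [cosetCount_eq_card_filter hmem, hg, E_five]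
    omega
  · obtain ⟨g, hg⟩ : ∃ g : Perm (Fin 5),
        ((frobenius 10).filter fun h => ∀ i, g (h i) ≠ i).card = 4 := by decide +kernel
    refine ⟨g, ?_⟩
    rw [cosetCount_eq_card_filter hmem, hg, E_five]
    omega
  · obtain ⟨g, hg⟩ : ∃ g : Perm (Fin 5),
        ((frobenius 20).filter fun h => ∀ i, g (h i) ≠ i).card = 8 := by decide +kernel
    refine ⟨g, ?_⟩
    rw [cosetCount_eq_card_filter hmem, hg, E_five]
    omega

theorem isPretransitive_of_map_conj {α : Type*} {G : Subgroup (Perm α)} (x : Perm α)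
    (h : IsPretransitive (G.map (MulAut.conj x).toMonoidHom) α) : IsPretransitive G α := by
  refine ⟨fun a b => ?_⟩
  obtain ⟨⟨g, hg⟩, hgab⟩ := h.exists_smul_eq (x a) (x b)
  refine ⟨⟨_, mem_map_conj.1 hg⟩, ?_⟩
  change (x⁻¹ * g * x) a = b
  change g (x a) = x b at hgab
  simp [hgab]

theorem isPreprimitive {G : Subgroup (Perm (Fin 5))} (h : ¬ 5 ∣ G.index) :
    IsPreprimitive G (Fin 5) := by
  obtain ⟨x, hx⟩ := exists_conj_finRotate_mem h
  have hrot : ∀ a b : Fin 5, ∃ k : Fin 5, (finRotate 5 ^ (k : ℕ)) a = b := by decide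
  have : IsPretransitive G (Fin 5) := by
    refine isPretransitive_of_map_conj x ⟨fun a b => ?_⟩
    obtain ⟨k, hk⟩ := hrot a b
    exact ⟨⟨_, pow_mem hx k⟩, hk⟩
  exact IsPreprimitive.of_prime_card (by
    rw [Nat.card_eq_fintype_card, Fintype.card_fin]
    exact Nat.prime_five)

theorem isExceptional_of_exists {G : Subgroup (Perm (Fin 5))}
    (hG : G ≠ alternatingGroup (Fin 5)) {g : Perm (Fin 5)}
    (hg : (cosetCount G g : ℤ) * G.index = E 5) : IsExceptional 5 G := by
  have h0 := card_mul_index_eq G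
  rw [show 5 ! = 120 from rfl] at h0
  have h24 : G.index ∣ 24 := by
    have h1 : (G.index : ℤ) ∣ 48 := Dvd.intro_left _ (hg.trans E_five)
    exact (Nat.dvd_gcd (by exact_mod_cast h1) (Dvd.intro_left _ h0) : G.index ∣ Nat.gcd 48 120)
  have h5 : ¬ 5 ∣ G.index := fun h => absurd (h.trans h24) (by norm_num)
  have hprim := isPreprimitive h5
  -- Otherwise `G`, primitive of prime degree, contains a 3-cycle. Likewise index 3 would give a
  -- transposition. The index is then 6, 12 or 24.
  have h3 : 3 ∣ G.index := by
    by_contra h3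
    have := Fact.mk Nat.prime_three
    obtain ⟨σ, hσ, -, hs⟩ := exists_isCycle_mem h3 (by simp)
    exact hG (eq_alternatingGroup_of_le (by norm_num) hg
      (Perm.alternatingGroup_le_of_isPreprimitive_of_isThreeCycle_mem hprim
        (card_support_eq_three_iff.1 hs) hσ))
  have h2 : G.index ≠ 3 := by
    intro h3'
    have := Fact.mk Nat.prime_two
    obtain ⟨σ, hσ, -, hs⟩ := exists_isCycle_mem (p := 2) (G := G) (by rw [h3']; norm_num) (by simp)
    exact index_ne_one (by norm_num) hg
      (Perm.subgroup_eq_top_of_isPreprimitive_of_isSwap_mem hprim σ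
        (Perm.card_support_eq_two.1 hs) hσ)
  change Nat.card G = 5 ∨ Nat.card G = 10 ∨ Nat.card G = 20
  have h4 := Nat.le_of_dvd (by norm_num) h24
  obtain ⟨k, hk⟩ := h3
  rw [hk] at h24 h2 h4 h0
  have hk8 : k ∣ 8 := Nat.dvd_of_mul_dvd_mul_left (by norm_num : 0 < 3) h24
  have : k ≤ 8 := by omega
  interval_cases k <;> omega

theorem exists_iff_isExceptional {G : Subgroup (Perm (Fin 5))}
    (hG : G ≠ alternatingGroup (Fin 5)) :
    (∃ g, (cosetCount G g : ℤ) * G.index = E 5) ↔ IsExceptional 5 G :=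
  ⟨fun ⟨_, hg⟩ => isExceptional_of_exists hG hg, exists_of_isExceptional⟩

end Five

end DerangementProportion

namespace DerangementProportion
open Equiv MulAction

/-! ### Degree six -/

theorem isConjSubgroup_of_map_conj {n : ℕ} {G H : Subgroup (Perm (Fin n))} (x : Perm (Fin n))
    (h : IsConjSubgroup (G.map (MulAut.conj x).toMonoidHom) H) : IsConjSubgroup G H := by
  obtain ⟨y, hy⟩ := h
  refine ⟨x⁻¹ * y, ?_⟩
  rw [← map_conj_map_conj_inv G x, hy]
  ext z
  simp only [mem_map_conj, mul_inv_rev, inv_inv, mul_assoc]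

namespace Six

theorem E_six : E 6 = 260 := by norm_num [E, numDerangements]

/-- A group of degree six with a suitable coset, other than the alternating group, preserves a
partition into two sets of three points. -/
theorem exists_splitting {G : Subgroup (Perm (Fin 6))} (hG : G ≠ alternatingGroup (Fin 6))
    {g : Perm (Fin 6)} (hg : (cosetCount G g : ℤ) * G.index = E 6) :
    ∃ s : Set (Fin 6), s.ncard = 3 ∧ ∀ σ ∈ G, (∀ i ∈ s, σ i ∈ s) ∨ (∀ i ∈ s, σ i ∉ s) := by
  have hd : (G.index : ℤ) ∣ E 6 := Dvd.intro_left _ hg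
  have h3 : ¬ 3 ∣ G.index := not_dvd_index_of_not_dvd_E hd (by rw [E_six]; norm_num)
  have := Fact.mk Nat.prime_three
  by_cases htrans : IsPretransitive G (Fin 6)
  · by_cases hprim : IsPreprimitive G (Fin 6)
    · obtain ⟨σ, hσ, -, hs⟩ := exists_isCycle_mem h3 (by simp)
      exact absurd (eq_alternatingGroup_of_le (by norm_num) hg
        (Perm.alternatingGroup_le_of_isPreprimitive_of_isThreeCycle_mem hprim
          (card_support_eq_three_iff.1 hs) hσ)) hG
    · obtain ⟨B, hB, hnt, huniv⟩ := exists_block_of_not_isPreprimitive hprim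
      have hab := hB.ncard_block_mul_ncard_orbit_eq hnt.nonempty
      rw [Nat.card_eq_fintype_card, Fintype.card_fin] at hab
      have hb : 2 ≤ B.ncard := (Set.one_lt_ncard_iff_nontrivial).2 hnt
      -- As 6 mod 3 = 0, the block size is a multiple of 3.
      have hmod := ncard_orbit_mul_mod h3 hB hnt
      rw [Fintype.card_fin] at hmod
      have hb6 : B.ncard ≠ 6 := fun h => huniv ((Set.eq_univ_iff_ncard B).2 (by simpa using h))
      have ha : (orbit G B).ncard ≠ 0 := by
        intro h
        rw [h] at hab
        omega
      have hb3 : B.ncard % 3 = 0 := by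
        rcases Nat.mul_eq_zero.1 hmod with h | h
        · exact absurd h ha
        · exact h
      have hle : B.ncard ≤ 6 := Nat.le_of_dvd (by norm_num) (Dvd.intro _ hab)
      refine ⟨B, by omega, fun σ hσ => ?_⟩
      rcases hB.smul_eq_or_disjoint ⟨σ, hσ⟩ with h | h
      · left
        intro i hi
        rw [← h]
        exact Set.smul_mem_smul_set hi
      · right
        intro i hi hi'
        exact Set.disjoint_left.1 h (Set.smul_mem_smul_set hi) hi'
  · obtain ⟨s, -, hs, hinv, -⟩ := exists_invariant_of_not_isPretransitive hd htrans
    exact ⟨s, by rw [Set.ncard_coe_finset]; omega, fun σ hσ => Or.inl (hinv σ hσ)⟩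

/-- `σ` preserves the partition `{{0, 1, 2}, {3, 4, 5}}`. -/
abbrev Splits (σ : Perm (Fin 6)) : Prop := ∀ i j, ((σ i < 3 ↔ σ j < 3) ↔ (i < 3 ↔ j < 3))

/-- `σ` preserves the set `{0, 1, 2}`. -/
abbrev Preserves (σ : Perm (Fin 6)) : Prop := σ 0 < 3 ∧ σ 1 < 3 ∧ σ 2 < 3

/-- The wreath product of order `72`. -/
def wreath : Subgroup (Perm (Fin 6)) where
  carrier := {σ | Splits σ}
  one_mem' := fun _ _ => Iff.rfl
  mul_mem' := fun {a b} ha hb i j => (ha (b i) (b j)).trans (hb i j)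
  inv_mem' := fun {a} ha i j => by
    have := ha (a⁻¹ i) (a⁻¹ j)
    simp at this
    exact this.symm

/-- Representatives of the cosets of `wreath`. -/
def reps : List (Perm (Fin 6)) :=
  [1, swap 0 3, swap 0 4, swap 0 5, swap 1 3, swap 1 4, swap 1 5, swap 2 3, swap 2 4, swap 2 5]

abbrev a : Perm (Fin 6) := swap 0 1
abbrev b : Perm (Fin 6) := swap 3 4
abbrev c₁ : Perm (Fin 6) := cyc [0, 1, 2]
abbrev c₂ : Perm (Fin 6) := cyc [3, 4, 5]
abbrev y₁ : Perm (Fin 6) := cyc [0, 3, 1, 4] * cyc [2, 5]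
abbrev y₂ : Perm (Fin 6) := Equiv.addRight 3

theorem splits_iff : ∀ σ : Perm (Fin 6), Splits σ ↔ Preserves σ ∨ Preserves (y₂ * σ) := by
  decide +kernel

theorem exists_rep_preserves : ∀ g : Perm (Fin 6), ∃ r ∈ reps,
    Preserves (r * g) ∨ Preserves (y₂ * (r * g)) := by
  decide +kernel

/-- The elements of `wreath`. -/
def wreathFinset : Finset (Perm (Fin 6)) :=
  Finset.univ.filter fun σ => Preserves σ ∨ Preserves (y₂ * σ)

/-- The stabiliser of `{0, 1, 2}`. -/
def youngFinset : Finset (Perm (Fin 6)) := Finset.univ.filter Preserves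

theorem card_wreathFinset : wreathFinset.card = 72 := by decide +kernel

theorem card_youngFinset : youngFinset.card = 36 := by decide +kernel

/-- Index 10 would require 260 / 10 = 26 derangements; for index 20 below the number is 13. -/
theorem count_wreathFinset : ∀ r ∈ reps,
    (wreathFinset.filter fun h => ∀ i, r (h i) ≠ i).card ≠ 26 := by
  decide +kernel

theorem count_youngFinset : ∀ r ∈ reps,
    (youngFinset.filter fun h => ∀ i, r (h i) ≠ i).card ≠ 13 ∧
    (youngFinset.filter fun h => ∀ i, r (y₂ (h i)) ≠ i).card ≠ 13 := by
  decide +kernel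

theorem preserves_words : ∀ σ : Perm (Fin 6), Preserves σ →
    ∃ (i : Fin 3) (k : Fin 2) (j : Fin 3) (l : Fin 2),
      σ = c₁ ^ (i : ℕ) * a ^ (k : ℕ) * (c₂ ^ (j : ℕ) * b ^ (l : ℕ)) := by
  decide +kernel

theorem exists_map_lt_three {s : Set (Fin 6)} (hs : s.ncard = 3) :
    ∃ x : Perm (Fin 6), ∀ i, x i < 3 ↔ i ∈ s := by
  classical
  have h1 : Fintype.card s = Fintype.card {i : Fin 6 // i < 3} := by
    rw [← Nat.card_eq_fintype_card, Nat.card_coe_set_eq, hs]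
    decide
  set e : {i // i ∈ s} ≃ {i : Fin 6 // i < 3} := Fintype.equivOfCardEq h1
  refine ⟨e.extendSubtype, fun i => ⟨fun h => ?_, e.extendSubtype_mem i⟩⟩
  by_contra hi
  exact e.extendSubtype_not_mem i hi h

theorem map_conj_le_wreath {G : Subgroup (Perm (Fin 6))} {s : Set (Fin 6)}
    (h : ∀ σ ∈ G, (∀ i ∈ s, σ i ∈ s) ∨ (∀ i ∈ s, σ i ∉ s)) {x : Perm (Fin 6)}
    (hx : ∀ i, x i < 3 ↔ i ∈ s) : G.map (MulAut.conj x).toMonoidHom ≤ wreath := by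
  intro τ hτ
  rw [mem_map_conj] at hτ
  refine (splits_iff τ).2 ?_
  have hmem : ∀ i, i < 3 → x⁻¹ i ∈ s := fun i hi => by
    rw [← hx]
    simpa using hi
  have hval : ∀ i, (x⁻¹ * τ * x) (x⁻¹ i) ∈ s ↔ τ i < 3 := fun i => by
    rw [← hx]
    simp
  have hy : ∀ i : Fin 6, ¬ i < 3 → y₂ i < 3 := by decide
  rcases h _ hτ with h | h
  · left
    exact ⟨(hval 0).1 (h _ (hmem 0 (by decide))), (hval 1).1 (h _ (hmem 1 (by decide))),
      (hval 2).1 (h _ (hmem 2 (by decide)))⟩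
  · right
    exact ⟨hy _ fun h0 => h _ (hmem 0 (by decide)) ((hval 0).2 h0),
      hy _ fun h0 => h _ (hmem 1 (by decide)) ((hval 1).2 h0),
      hy _ fun h0 => h _ (hmem 2 (by decide)) ((hval 2).2 h0)⟩

theorem mem_wreath {σ : Perm (Fin 6)} : σ ∈ wreath ↔ σ ∈ wreathFinset := by
  rw [wreathFinset, Finset.mem_filter, ← splits_iff]
  exact ⟨fun h => ⟨Finset.mem_univ _, h⟩, fun h => h.2⟩

theorem card_wreath : Nat.card wreath = 72 := by
  rw [← card_wreathFinset, ← Set.ncard_coe_finset]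
  change (wreath : Set (Perm (Fin 6))).ncard = _
  congr 1
  ext σ
  exact mem_wreath

theorem inv_of_mem_reps : ∀ r ∈ reps, r⁻¹ = r := by decide +kernel

theorem mem_wreath_of_preserves {σ : Perm (Fin 6)} (h : Preserves σ) : σ ∈ wreath :=
  (splits_iff σ).2 (Or.inl h)

theorem y₂_mem_wreath : y₂ ∈ wreath := (splits_iff y₂).2 (Or.inr (by decide))

theorem cosetCount_wreath_ne (g : Perm (Fin 6)) : cosetCount wreath g ≠ 26 := by
  obtain ⟨r, hr, h⟩ := exists_rep_preserves g
  have hm : r * g ∈ wreath := by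
    rcases h with h | h
    · exact mem_wreath_of_preserves h
    · have := mul_mem (inv_mem y₂_mem_wreath) (mem_wreath_of_preserves h)
      rwa [inv_mul_cancel_left] at this
  have hr' : r * r = 1 := by rw [mul_eq_one_iff_eq_inv, inv_of_mem_reps r hr]
  have hg : g = r * (r * g) := by rw [← mul_assoc, hr', one_mul]
  rw [hg, cosetCount_mul_right r hm, cosetCount_eq_card_filter (fun σ => mem_wreath)]
  exact count_wreathFinset r hr

theorem cosetCount_young_ne {G : Subgroup (Perm (Fin 6))} (hG : ∀ σ, σ ∈ G ↔ σ ∈ youngFinset)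
    (g : Perm (Fin 6)) : cosetCount G g ≠ 13 := by
  have hG' : ∀ σ, Preserves σ → σ ∈ G := fun σ h =>
    (hG σ).2 (Finset.mem_filter.2 ⟨Finset.mem_univ _, h⟩)
  obtain ⟨r, hr, h⟩ := exists_rep_preserves g
  have hr' : r * r = 1 := by rw [mul_eq_one_iff_eq_inv, inv_of_mem_reps r hr]
  have hy : y₂ * y₂ = 1 := by decide
  rcases h with h | h
  · have hg : g = r * (r * g) := by rw [← mul_assoc, hr', one_mul]
    rw [hg, cosetCount_mul_right r (hG' _ h), cosetCount_eq_card_filter hG]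
    exact (count_youngFinset r hr).1
  · have hg : g = r * y₂ * (y₂ * (r * g)) := by
      rw [mul_assoc, ← mul_assoc y₂, hy, one_mul, ← mul_assoc, hr', one_mul]
    rw [hg, cosetCount_mul_right (r * y₂) (hG' _ h), cosetCount_eq_card_filter hG]
    exact (count_youngFinset r hr).2

abbrev generators₁ : Set (Perm (Fin 6)) :=
  {cyc [0, 5, 1, 2] * cyc [3, 4], cyc [0, 1] * cyc [2, 5],
    cyc [0, 1, 3] * cyc [2, 5, 4], cyc [0, 3, 1] * cyc [2, 5, 4]}

abbrev generators₂ : Set (Perm (Fin 6)) :=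
  {cyc [0, 2] * cyc [1, 4] * cyc [3, 5], cyc [0, 3] * cyc [2, 5],
    cyc [0, 4, 3] * cyc [1, 2, 5], cyc [0, 3, 4] * cyc [1, 2, 5]}

def words₁ : Finset (Perm (Fin 6)) :=
  (Finset.univ : Finset (Fin 3 × Fin 3 × Fin 4)).image fun p =>
    (cyc [0, 1, 3] * cyc [2, 5, 4]) ^ (p.1 : ℕ) * (cyc [0, 3, 1] * cyc [2, 5, 4]) ^ (p.2.1 : ℕ) *
      (cyc [0, 5, 1, 2] * cyc [3, 4]) ^ (p.2.2 : ℕ)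

def words₂ : Finset (Perm (Fin 6)) :=
  (Finset.univ : Finset (Fin 3 × Fin 3 × Fin 2 × Fin 2)).image fun p =>
    (cyc [0, 4, 3] * cyc [1, 2, 5]) ^ (p.1 : ℕ) * (cyc [0, 3, 4] * cyc [1, 2, 5]) ^ (p.2.1 : ℕ) *
      (cyc [0, 2] * cyc [1, 4] * cyc [3, 5]) ^ (p.2.2.1 : ℕ) *
      (cyc [0, 3] * cyc [2, 5]) ^ (p.2.2.2 : ℕ)

theorem mem_closure_of_mem_words₁ : ∀ σ ∈ words₁, σ ∈ Subgroup.closure generators₁ := by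
  intro σ hσ
  obtain ⟨p, -, rfl⟩ := Finset.mem_image.1 hσ
  refine mul_mem (mul_mem (pow_mem ?_ _) (pow_mem ?_ _)) (pow_mem ?_ _) <;>
    exact Subgroup.subset_closure (by
      simp only [Set.mem_insert_iff, Set.mem_singleton_iff, true_or, or_true])

theorem mem_closure_of_mem_words₂ : ∀ σ ∈ words₂, σ ∈ Subgroup.closure generators₂ := by
  intro σ hσ
  obtain ⟨p, -, rfl⟩ := Finset.mem_image.1 hσ
  refine mul_mem (mul_mem (mul_mem (pow_mem ?_ _) (pow_mem ?_ _)) (pow_mem ?_ _))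
    (pow_mem ?_ _) <;>
    exact Subgroup.subset_closure (by
      simp only [Set.mem_insert_iff, Set.mem_singleton_iff, true_or, or_true])

theorem card_words₁ : words₁.card = 36 := by decide +kernel

theorem card_words₂ : words₂.card = 36 := by decide +kernel

theorem count_words₁ : (words₁.filter fun h => ∀ i, swap 3 4 (h i) ≠ i).card = 13 := by
  decide +kernel

theorem count_words₂ : (words₂.filter fun h => ∀ i, swap 4 5 (h i) ≠ i).card = 13 := by
  decide +kernel

theorem exists_of_isExceptional {G : Subgroup (Perm (Fin 6))} (h : IsExceptional 6 G) :
    ∃ g, (cosetCount G g : ℤ) * G.index = E 6 := by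
  rcases h with ⟨hcard, h⟩ | ⟨hcard, h⟩
  · refine exists_cosetCount_of_isConjSubgroup h mem_closure_of_mem_words₁
      (hcard.trans card_words₁.symm) ⟨swap 3 4, ?_⟩
    rw [count_words₁, card_words₁, E_six]
    rfl
  · refine exists_cosetCount_of_isConjSubgroup h mem_closure_of_mem_words₂
      (hcard.trans card_words₂.symm) ⟨swap 4 5, ?_⟩
    rw [count_words₂, card_words₂, E_six]
    rfl

theorem isConjSubgroup_of_generators_mem {G : Subgroup (Perm (Fin 6))} (hcard : Nat.card G = 36)
    {S : Set (Perm (Fin 6))} {F : Finset (Perm (Fin 6))}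
    (hF : ∀ σ ∈ F, σ ∈ Subgroup.closure S) (hc : F.card = 36) (x : Perm (Fin 6))
    (h : ∀ s ∈ S, x * s * x⁻¹ ∈ G) : IsConjSubgroup G (Subgroup.closure S) := by
  refine isConjSubgroup_of_map_conj_eq x⁻¹ (eq_closure_of_card_le (fun s hs => ?_) hF ?_)
  · rw [mem_map_conj, inv_inv]
    exact h s hs
  · rw [card_map_conj, hcard, hc]

/-- A subgroup of index two of the wreath product with a suitable coset is exceptional. -/
theorem isExceptional_of_le_wreath {G : Subgroup (Perm (Fin 6))} (hle : G ≤ wreath)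
    (hcard : Nat.card G = 36) {g : Perm (Fin 6)} (hg : cosetCount G g = 13) :
    IsExceptional 6 G := by
  have hindex : (G.subgroupOf wreath).index = 2 := by
    have := Subgroup.card_mul_index (G.subgroupOf wreath)
    rw [card_wreath, Nat.card_congr (Subgroup.subgroupOfEquivOfLe hle).toEquiv, hcard] at this
    omega
  have hmul : ∀ σ τ, σ ∈ wreath → τ ∈ wreath → (σ * τ ∈ G ↔ (σ ∈ G ↔ τ ∈ G)) :=
    fun σ τ hσ hτ => Subgroup.mul_mem_iff_of_index_two hindex (a := ⟨σ, hσ⟩) (b := ⟨τ, hτ⟩)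
  have hsq : ∀ σ, σ ∈ wreath → σ * σ ∈ G := fun σ hσ =>
    Subgroup.mul_self_mem_of_index_two hindex ⟨σ, hσ⟩
  have hc1W : c₁ ∈ wreath := mem_wreath_of_preserves (by decide)
  have hc2W : c₂ ∈ wreath := mem_wreath_of_preserves (by decide)
  have haW : a ∈ wreath := mem_wreath_of_preserves (by decide)
  have hbW : b ∈ wreath := mem_wreath_of_preserves (by decide)
  have hy1W : y₁ ∈ wreath := (splits_iff y₁).2 (Or.inr (by decide))
  -- A subgroup of index two contains all squares, so `c₁`, `c₂` and `a * b` lie in `G`. Which of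
  -- `a`, `y₁`, `y₂` belongs to `G` then determines it among three subgroups; the one containing `a`
  -- is the stabiliser of `{0, 1, 2}`, excluded by counting.
  have hc1 : c₁ ∈ G := by
    rw [show c₁ = (c₁ * c₁) * (c₁ * c₁) by decide]
    exact hsq _ (mul_mem hc1W hc1W)
  have hc2 : c₂ ∈ G := by
    rw [show c₂ = (c₂ * c₂) * (c₂ * c₂) by decide]
    exact hsq _ (mul_mem hc2W hc2W)
  have hab : a * b ∈ G := by
    rw [show a * b = y₁ * y₁ by decide]
    exact hsq _ hy1W
  have hab' := (hmul a b haW hbW).1 hab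
  by_cases ha : a ∈ G
  · exfalso
    have hb := hab'.1 ha
    refine cosetCount_young_ne (mem_iff_of_finset_subset ?_ ?_) g hg
    · intro σ hσ
      obtain ⟨i, k, j, l, rfl⟩ := preserves_words σ (Finset.mem_filter.1 hσ).2
      exact mul_mem (mul_mem (pow_mem hc1 _) (pow_mem ha _))
        (mul_mem (pow_mem hc2 _) (pow_mem hb _))
    · rw [hcard, card_youngFinset]
  · have hb : b ∉ G := fun hb => ha (hab'.2 hb)
    rw [show b = y₂ * y₁ by decide, hmul _ _ y₂_mem_wreath hy1W] at hb
    by_cases hy1 : y₁ ∈ G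
    · left
      -- The conjugating cycle carries `{0, 1, 3}`, a block of the listed group, to `{0, 1, 2}`; in
      -- the other case it carries `{0, 3, 4}` there.
      refine ⟨hcard, isConjSubgroup_of_generators_mem hcard mem_closure_of_mem_words₁ card_words₁
        (cyc [2, 4, 5, 3]) ?_⟩
      rintro s (rfl | rfl | rfl | rfl)
      · rwa [show cyc [2, 4, 5, 3] * (cyc [0, 5, 1, 2] * cyc [3, 4]) * (cyc [2, 4, 5, 3])⁻¹ = y₁
          by decide]
      · rwa [show cyc [2, 4, 5, 3] * (cyc [0, 1] * cyc [2, 5]) * (cyc [2, 4, 5, 3])⁻¹ = a * b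
          by decide]
      · rw [show cyc [2, 4, 5, 3] * (cyc [0, 1, 3] * cyc [2, 5, 4]) * (cyc [2, 4, 5, 3])⁻¹ =
          c₁ * (c₂ * c₂) by decide]
        exact mul_mem hc1 (mul_mem hc2 hc2)
      · rw [show cyc [2, 4, 5, 3] * (cyc [0, 3, 1] * cyc [2, 5, 4]) * (cyc [2, 4, 5, 3])⁻¹ =
          (c₁ * c₁) * (c₂ * c₂) by decide]
        exact mul_mem (mul_mem hc1 hc1) (mul_mem hc2 hc2)
    · have hy2 : y₂ ∈ G := by
        by_contra hy2
        exact hb ⟨fun h => absurd h hy2, fun h => absurd h hy1⟩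
      right
      refine ⟨hcard, isConjSubgroup_of_generators_mem hcard mem_closure_of_mem_words₂ card_words₂
        (cyc [1, 5, 4, 2, 3]) ?_⟩
      rintro s (rfl | rfl | rfl | rfl)
      · rwa [show cyc [1, 5, 4, 2, 3] * (cyc [0, 2] * cyc [1, 4] * cyc [3, 5]) *
          (cyc [1, 5, 4, 2, 3])⁻¹ = y₂ by decide]
      · rwa [show cyc [1, 5, 4, 2, 3] * (cyc [0, 3] * cyc [2, 5]) * (cyc [1, 5, 4, 2, 3])⁻¹ =
          a * b by decide]
      · rw [show cyc [1, 5, 4, 2, 3] * (cyc [0, 4, 3] * cyc [1, 2, 5]) *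
          (cyc [1, 5, 4, 2, 3])⁻¹ = (c₁ * c₁) * c₂ by decide]
        exact mul_mem (mul_mem hc1 hc1) hc2
      · rw [show cyc [1, 5, 4, 2, 3] * (cyc [0, 3, 4] * cyc [1, 2, 5]) *
          (cyc [1, 5, 4, 2, 3])⁻¹ = c₁ * c₂ by decide]
        exact mul_mem hc1 hc2

theorem isExceptional_of_exists {G : Subgroup (Perm (Fin 6))}
    (hG : G ≠ alternatingGroup (Fin 6)) {g : Perm (Fin 6)}
    (hg : (cosetCount G g : ℤ) * G.index = E 6) : IsExceptional 6 G := by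
  obtain ⟨s, hs, hsG⟩ := exists_splitting hG hg
  obtain ⟨x, hx⟩ := exists_map_lt_three hs
  have hle := map_conj_le_wreath hsG hx
  have h20 : G.index ∣ 20 := by
    have h1 : (G.index : ℤ) ∣ 260 := Dvd.intro_left _ (hg.trans E_six)
    exact (Nat.dvd_gcd (by exact_mod_cast h1) (Dvd.intro_left _ (card_mul_index_eq G)) :
      G.index ∣ Nat.gcd 260 720)
  have hg' : cosetCount (G.map (MulAut.conj x).toMonoidHom) (x * g * x⁻¹) * G.index = 260 := by
    rw [E_six] at hg
    rw [cosetCount_conj]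
    exact_mod_cast hg
  have h0 := card_mul_index_eq G
  rw [show 6 ! = 720 from rfl, ← card_map_conj G x] at h0
  have h72 : Nat.card (G.map (MulAut.conj x).toMonoidHom) ≤ 72 := by
    rw [← card_wreath]
    exact Subgroup.card_le_of_le hle
  -- The order is at most 72, so the index is at least 10, and it divides gcd(260, 720) = 20.
  have hi : G.index = 10 ∨ G.index = 20 := by
    have h1 : 10 ≤ G.index := by
      by_contra h
      have := Nat.mul_le_mul h72 (show G.index ≤ 9 by omega)
      omega
    have h2 := Nat.le_of_dvd (by norm_num) h20
    interval_cases G.index <;> omega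
  rcases hi with hi | hi <;> rw [hi] at h0 hg'
  · have : G.map (MulAut.conj x).toMonoidHom = wreath :=
      Subgroup.eq_of_le_of_card_ge hle (by rw [card_wreath]; omega)
    rw [this] at hg'
    exact absurd (by omega) (cosetCount_wreath_ne (x * g * x⁻¹))
  · have hc : Nat.card (G.map (MulAut.conj x).toMonoidHom) = 36 := by omega
    rcases isExceptional_of_le_wreath hle hc (g := x * g * x⁻¹) (by omega) with ⟨-, h⟩ | ⟨-, h⟩
    · exact Or.inl ⟨by rw [← card_map_conj G x, hc], isConjSubgroup_of_map_conj x h⟩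
    · exact Or.inr ⟨by rw [← card_map_conj G x, hc], isConjSubgroup_of_map_conj x h⟩

theorem exists_iff_isExceptional {G : Subgroup (Perm (Fin 6))}
    (hG : G ≠ alternatingGroup (Fin 6)) :
    (∃ g, (cosetCount G g : ℤ) * G.index = E 6) ↔ IsExceptional 6 G :=
  ⟨fun ⟨_, hg⟩ => isExceptional_of_exists hG hg, exists_of_isExceptional⟩

end Six

end DerangementProportion

/-! ### Assembly of the three statements -/

theorem theorem5p1 :
    -- the proportion of fixed-point-free elements of `A_n` is `E_n / n!`
    (∀ n : ℕ, 1 ≤ n →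
      DerangementProportion.fpfProportion
          (alternatingGroup (Fin n) : Set (Equiv.Perm (Fin n))) =
        (DerangementProportion.E n : ℚ) / (n ! : ℚ)) ∧
    -- for `n ≥ 7` this proportion characterizes `A_n`
    (∀ n : ℕ, 7 ≤ n → ∀ (G : Subgroup (Equiv.Perm (Fin n))) (C : Set (Equiv.Perm (Fin n))),
      DerangementProportion.IsCosetOf C G →
      DerangementProportion.fpfProportion C =
        DerangementProportion.fpfProportion
          (alternatingGroup (Fin n) : Set (Equiv.Perm (Fin n))) →
      G = alternatingGroup (Fin n)) ∧
    -- for `n ≤ 6`, the complete list of counterexamples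
    (∀ n : ℕ, n ≤ 6 → ∀ G : Subgroup (Equiv.Perm (Fin n)), G ≠ alternatingGroup (Fin n) →
      ((∃ C : Set (Equiv.Perm (Fin n)), DerangementProportion.IsCosetOf C G ∧
          DerangementProportion.fpfProportion C =
            DerangementProportion.fpfProportion
              (alternatingGroup (Fin n) : Set (Equiv.Perm (Fin n)))) ↔
        DerangementProportion.IsExceptional n G)) := by
  refine ⟨DerangementProportion.fpfProportion_alternatingGroup, fun n hn G C hC h => ?_,
    fun n hn G hG => ?_⟩
  · obtain ⟨g, hg⟩ :=
      DerangementProportion.exists_cosetCount_of_isCosetOf (by omega) hC h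
    exact DerangementProportion.eq_alternatingGroup_of_seven_le hn hg
  -- For `n ≤ 1` the symmetric group is trivial, so no subgroup differs from the alternating group.
  · rcases Nat.lt_or_ge n 2 with h2 | h2
    · have : Subsingleton (Fin n) := Fin.subsingleton_iff_le_one.2 (by omega)
      exact absurd (Subsingleton.elim _ _) hG
    rw [DerangementProportion.exists_isCosetOf_iff (by omega)]
    rcases Nat.lt_or_ge 3 n with h3 | h3
    · interval_cases n
      · exact DerangementProportion.Four.exists_iff_isExceptional hG
      · exact DerangementProportion.Five.exists_iff_isExceptional hG
      · exact DerangementProportion.Six.exists_iff_isExceptional hG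
    · refine iff_of_false (DerangementProportion.not_exists_cosetCount_of_le_three h2 h3 hG) ?_
      interval_cases n <;> exact id
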